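/- Let $q$ be a prime power and let $V$ be a unitary space of dimension $n\ge 2$ over $\mathrm{GF}(q^2)$, that is, an $n$-dimensional vector space over the field with $q^2$ elements together with a non-degenerate Hermitian form $\Psi$ with respect to the field automorphism $\tau$ of order $2$ (so $\tau(x)=x^q$). Let $\mathcal G(V)$ be the simple graph whose vertices are the $1$-dimensional subspaces of $V$ on which $\Psi$ is non-degenerate, two vertices being adjacent if and only if they are orthogonal with respect to $\Psi$. Put $$d_n=\frac{q^{n-2}\bigl(q^{n-1}-(-1)^{n-1}\bigr)}{q+1}$$ and $$\mu_1=d_n,\qquad \mu_2=q^{n-2},\qquad \mu_3=(-1)^n q^{n-3},\qquad \mu_4=-q^{n-2}.$$ Then the set of eigenvalues of the adjacency matrix of $\mathcal G(V)$ is as follows. (i) If $n=2$, it is $\{\mu_1,\mu_4\}$. (ii) If $n\ge 3$ and $q\ne 2$, it is $\{\mu_1,\mu_2,\mu_3,\mu_4\}$. (iii) If $n=3$ and $q=2$, it is $\{\mu_1,\mu_3\}$. (iv) If $n>3$ and $q=2$, it is $\{\mu_1,\mu_3,(-1)^n\mu_4\}$. -/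

import Mathlib

/-- A unitary form: a non-degenerate Hermitian form `Ψ` (linear in the first argument,
`τ`-semilinear in the second) with respect to a field automorphism `τ` of order `2`. -/
structure IsUnitaryForm {K V : Type*} [Field K] [AddCommGroup V] [Module K V] (τ : K ≃+* K)
    (Ψ : V →ₗ[K] V →ₛₗ[(τ : K →+* K)] K) : Prop where
  orderOf_eq : orderOf (τ : RingAut K) = 2
  hermitian : ∀ v w : V, Ψ v w = τ (Ψ w v)
  nondegenerate : Ψ.Nondegenerate

/-- A subspace is non-degenerate if the restriction of the form to it is non-degenerate. -/
def IsNondegenerateSubspace {K V : Type*} [Field K] [AddCommGroup V] [Module K V] {τ : K ≃+* K}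
    (Ψ : V →ₗ[K] V →ₛₗ[(τ : K →+* K)] K) (S : Submodule K V) : Prop :=
  (Ψ.domRestrict₁₂ S S).Nondegenerate

/-- The non-degenerate `1`-dimensional subspaces. -/
def FrameVertex {K V : Type*} [Field K] [AddCommGroup V] [Module K V] {τ : K ≃+* K}
    (Ψ : V →ₗ[K] V →ₛₗ[(τ : K →+* K)] K) : Type _ :=
  {S : Submodule K V // Module.finrank K S = 1 ∧ IsNondegenerateSubspace Ψ S}

noncomputable instance instFintypeFrameVertex {K V : Type*} [Field K] [AddCommGroup V]
    [Module K V] [Finite K] [FiniteDimensional K V] {τ : K ≃+* K}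
    (Ψ : V →ₗ[K] V →ₛₗ[(τ : K →+* K)] K) : Fintype (FrameVertex Ψ) :=
  haveI : Finite V := Module.finite_of_finite K
  haveI : Finite (Submodule K V) := Finite.of_injective _ SetLike.coe_injective
  haveI : Finite (FrameVertex Ψ) := Subtype.finite
  Fintype.ofFinite _

/-- The graph `G(V)` of a unitary space: the vertices are the non-degenerate `1`-dimensional
subspaces, two of them being adjacent if and only if they are orthogonal. -/
def frameGraph {K V : Type*} [Field K] [AddCommGroup V] [Module K V] {τ : K ≃+* K}
    {Ψ : V →ₗ[K] V →ₛₗ[(τ : K →+* K)] K} (hΨ : IsUnitaryForm τ Ψ) :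
    SimpleGraph (FrameVertex Ψ) where
  Adj S W := ∀ v ∈ S.1, ∀ w ∈ W.1, Ψ v w = 0
  symm := ⟨fun S W h w hw v hv => by rw [hΨ.hermitian, h v hv w hw, map_zero]⟩
  loopless := ⟨fun S h => by
    have h0 : ∀ v : S.1, v = 0 := fun v => S.2.2.1 v fun w => h v.1 v.2 w.1 w.2
    have : Subsingleton S.1 := ⟨fun a b => (h0 a).trans (h0 b).symm⟩
    have h1 := S.2.1
    rw [Module.finrank_zero_of_subsingleton] at h1
    exact zero_ne_one h1⟩

open Classical in
/-- The set of (real) eigenvalues of the adjacency matrix of a finite graph. -/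
noncomputable def adjacencyEigenvalues {α : Type*} [Fintype α] (G : SimpleGraph α) : Set ℝ :=
  {μ | Module.End.HasEigenvalue (Matrix.toLin' (G.adjMatrix ℝ)) μ}

/-- `d_n = q^(n-2) (q^(n-1) - (-1)^(n-1)) / (q + 1)`, as a real number (with integer exponents,
so that no subtraction is truncated). -/
noncomputable def unitaryDegree (q n : ℕ) : ℝ :=
  (q : ℝ) ^ ((n : ℤ) - 2) * ((q : ℝ) ^ ((n : ℤ) - 1) - (-1 : ℝ) ^ ((n : ℤ) - 1)) / ((q : ℝ) + 1)

/-! Write n = k + 2 and let A be the adjacency matrix, J the all-ones matrix and B the matrix of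
tangency: P = R, or P and R span a degenerate plane. Put b = (-1)^k q^k / q = μ₃, so that bq =
±q^(n-2). Everything rests on two identities: A² = b²(q² - q) I + b B + N J and (A - b)(B - bq) = c
J, with scalars N and c (`adjacency_mul_adjacency`, `adjacency_mul_tangency`).

Their entries count vertices orthogonal to two given ones, and vertices orthogonal to one and
tangent to another. Both reduce to counting isotropic vectors in v^⊥ and v^⊥ ∩ u^⊥, where the answer
depends only on whether the plane spanned by u and v is degenerate. These counts come from splitting
off one vector w at a time, using the fibre sizes of the norm (w nonisotropic) or of the trace (w
isotropic).

The graph is regular, so an eigenvalue other than the degree has an eigenvector of sum zero. On such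
vectors J vanishes, and eliminating B gives (A - b)(A - bq)(A + bq) = 0, which bounds the spectrum.
Conversely (B - bq)f and (A - b)(A + μ)f, with μ = ±bq, are eigenvectors whenever nonzero; f is a
difference of two basis vectors chosen to make one entry visibly nonzero.

Two cases degenerate. For n = 2 distinct vertices are never tangent, so B = I and A² = I. For q = 2
nonadjacent vertices are tangent, so B = J - A and the cubic drops to (A - b)(A + 2b) = 0. -/

open Finset

/-! ### Fixed field, trace and norm of the involution -/

section FieldInvolution

variable {K : Type*} [Field K] {τ : K ≃+* K}

lemma RingEquiv.apply_apply_of_orderOf_eq_two (hτ : orderOf (τ : RingAut K) = 2) (x : K) :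
    τ (τ x) = x := by
  have h : (τ : RingAut K) ^ 2 = 1 := by rw [← hτ]; exact pow_orderOf_eq_one _
  have := congrArg (fun f : RingAut K => f x) h
  simpa [pow_two] using this

lemma RingEquiv.exists_apply_ne_of_orderOf_eq_two (hτ : orderOf (τ : RingAut K) = 2) :
    ∃ a, τ a ≠ a := by
  by_contra! h
  have : (τ : RingAut K) = 1 := by ext x; exact h x
  rw [this, orderOf_one] at hτ
  omega

/-- For an involution `τ`, some trace `a + τ a` is nonzero. -/
lemma exists_add_apply_ne_zero (hτ : orderOf (τ : RingAut K) = 2) : ∃ a, a + τ a ≠ 0 := by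
  obtain ⟨a, ha⟩ := RingEquiv.exists_apply_ne_of_orderOf_eq_two hτ
  by_contra! h
  -- If all traces vanished, the trace of 1 would force characteristic 2, and then a + τ a = 0 would
  -- read τ a = a.
  have h1 := h 1
  rw [map_one] at h1
  apply ha
  have h2 := h a
  linear_combination h2 - a * h1

variable [Fintype K] {q : ℕ}

lemma one_lt_of_card_eq_sq (hq : Fintype.card K = q ^ 2) : 1 < q := by
  have := Fintype.one_lt_card (α := K)
  rw [hq] at this
  by_contra h
  interval_cases q <;> simp at this

variable [DecidableEq K]

/-- The fixed field of an involution of the field with `q ^ 2` elements has `q` elements. -/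
lemma card_fixedPoints (hτ : orderOf (τ : RingAut K) = 2) (hq : Fintype.card K = q ^ 2) :
    #{x : K | τ x = x} = q := by
  obtain ⟨a, ha⟩ := RingEquiv.exists_apply_ne_of_orderOf_eq_two hτ
  have hττ := RingEquiv.apply_apply_of_orderOf_eq_two hτ
  set F : Finset K := {x : K | τ x = x} with hF
  have hmem : ∀ x, x ∈ F ↔ τ x = x := fun x => by simp [hF]
  have hδ : a - τ a ≠ 0 := sub_ne_zero.2 (Ne.symm ha)
  have hδ' : τ a - a ≠ 0 := sub_ne_zero.2 ha
  -- 1 and a form a basis of K over the fixed field F; coordinates are found by solving for x and τ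
  -- x together.
  have hcard : #(F ×ˢ F) = #(univ : Finset K) := by
    refine Finset.card_bij (fun p _ => p.1 + p.2 * a) (fun _ _ => mem_univ _) ?_ ?_
    · rintro ⟨s, t⟩ h ⟨s', t'⟩ h' heq
      simp only [mem_product, hmem] at h h' heq
      have h2 := congrArg τ heq
      simp only [map_add, map_mul, h.1, h.2, h'.1, h'.2] at h2
      have h3 : (t - t') * (a - τ a) = 0 := by linear_combination heq - h2
      have ht : t = t' := sub_eq_zero.1 ((mul_eq_zero.1 h3).resolve_right hδ)
      subst ht
      simpa using heq
    · intro x _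
      refine ⟨(x - (x - τ x) / (a - τ a) * a, (x - τ x) / (a - τ a)), ?_, by ring⟩
      simp only [mem_product, hmem, map_sub, map_mul, map_div₀, hττ]
      constructor <;> · field_simp; ring
  rw [card_product, card_univ, hq, ← pow_two] at hcard
  exact Nat.pow_left_injective (n := 2) (by norm_num) hcard

/-- The trace onto the fixed field of an involution is `q`-to-one. -/
lemma card_trace_fiber (hτ : orderOf (τ : RingAut K) = 2) (hq : Fintype.card K = q ^ 2)
    {c k : K} (hc : τ c = c) (hk : k ≠ 0) : #{t : K | t * k + τ (t * k) = c} = q := by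
  obtain ⟨a, ha⟩ := RingEquiv.exists_apply_ne_of_orderOf_eq_two hτ
  have hττ := RingEquiv.apply_apply_of_orderOf_eq_two hτ
  obtain ⟨s, hs⟩ := exists_add_apply_ne_zero hτ
  have hδ : a - τ a ≠ 0 := sub_ne_zero.2 (Ne.symm ha)
  rw [← card_fixedPoints hτ hq]
  symm
  have hs' : τ s + s ≠ 0 := by rwa [add_comm]
  -- A particular solution for t * k; the others differ from it by fixed elements times a - τ a,
  -- which τ negates.
  have h0 : c * s / (s + τ s) + τ (c * s / (s + τ s)) = c := by
    simp only [map_add, map_mul, map_div₀, hττ, hc]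
    rw [add_comm (τ s) s]
    field_simp
  have hδτ : τ (a - τ a) = -(a - τ a) := by simp [hττ]
  refine Finset.card_bij (fun x _ => (x * (a - τ a) + c * s / (s + τ s)) / k) ?_ ?_ ?_
  · intro x hx
    simp only [mem_filter, mem_univ, true_and] at hx ⊢
    rw [div_mul_cancel₀ _ hk, map_add, map_mul, hx, hδτ]
    linear_combination h0
  · intro x _ y _ h
    rw [div_left_inj' hk] at h
    exact mul_right_cancel₀ hδ (add_right_cancel h)
  · intro t ht
    simp only [mem_filter, mem_univ, true_and] at ht
    refine ⟨(t * k - c * s / (s + τ s)) / (a - τ a), ?_, ?_⟩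
    · simp only [mem_filter, mem_univ, true_and]
      rw [map_div₀, hδτ, div_eq_div_iff (neg_ne_zero.2 hδ) hδ, map_sub]
      linear_combination (a - τ a) * (ht - h0)
    · rw [div_mul_cancel₀ _ hδ, sub_add_cancel, mul_div_cancel_right₀ _ hk]

/-- The norm onto the fixed field of an involution is `(q + 1)`-to-one off zero. -/
lemma card_norm_fiber (hτ : orderOf (τ : RingAut K) = 2) (hq : Fintype.card K = q ^ 2)
    {c : K} (hc : τ c = c) (hc0 : c ≠ 0) : #{t : K | t * τ t = c} = q + 1 := by
  have hττ := RingEquiv.apply_apply_of_orderOf_eq_two hτ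
  have hq1 : 1 < q := one_lt_of_card_eq_sq hq
  let T : Kˣ →* Kˣ := Units.map (τ : K →* K)
  have hT : ∀ u : Kˣ, ((T u : Kˣ) : K) = τ u := fun u => rfl
  -- N is the norm and D is u ↦ u / τ u. Hilbert 90 gives ker N = range D, and ker D has order q -
  -- 1, so ker N has order q + 1. Then range N ≤ ker D is an equality by order, and the fibre over c
  -- is a coset of ker N.
  let N : Kˣ →* Kˣ := MonoidHom.id Kˣ * T
  let D : Kˣ →* Kˣ := MonoidHom.id Kˣ / T
  have hN : ∀ u : Kˣ, N u = u * T u := fun u => rfl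
  have hD : ∀ u : Kˣ, D u = u / T u := fun u => rfl
  have hTT : ∀ u, T (T u) = u := fun u => Units.ext (by simp [hT, hττ])
  have hkerD : Nat.card D.ker = q - 1 := by
    have h1 : #(({x : K | τ x = x} : Finset K).erase 0) = q - 1 := by
      rw [card_erase_of_mem (by simp)]
      rw [card_fixedPoints hτ hq]
    rw [← h1, ← Nat.card_eq_finsetCard]
    refine Nat.card_congr ⟨fun u => ⟨((u : Kˣ) : K), ?_⟩, fun x => ⟨Units.mk0 x ?_, ?_⟩, ?_, ?_⟩
    · have hu : D u = 1 := u.2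
      rw [hD, div_eq_one] at hu
      have := congrArg (Units.val) hu
      rw [hT] at this
      simpa using this.symm
    · exact (mem_erase.1 x.2).1
    · have h2 := (mem_erase.1 x.2).2
      simp only [mem_filter, mem_univ, true_and] at h2
      rw [MonoidHom.mem_ker, hD, div_eq_one]
      exact Units.ext (by rw [hT]; simp [h2])
    · intro u; ext; simp
    · intro u; ext; simp
  have hker : N.ker = D.range := by
    ext u
    rw [MonoidHom.mem_ker, MonoidHom.mem_range, hN]
    constructor
    · intro h
      have hu : (u : K) * τ u = 1 := by simpa [hT] using congrArg Units.val h
      -- For u of norm 1, D sends 1 + u to u; the exception u = -1 is the image of a - τ a.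
      by_cases h1 : (1 : K) + u = 0
      · obtain ⟨a, ha⟩ := RingEquiv.exists_apply_ne_of_orderOf_eq_two hτ
        refine ⟨Units.mk0 (a - τ a) (sub_ne_zero.2 (Ne.symm ha)), ?_⟩
        rw [hD, div_eq_iff_eq_mul]
        refine Units.ext ?_
        rw [Units.val_mul, hT, Units.val_mk0, map_sub, hττ]
        linear_combination (a - τ a) * h1
      · refine ⟨Units.mk0 _ h1, ?_⟩
        rw [hD, div_eq_iff_eq_mul]
        refine Units.ext ?_
        rw [Units.val_mul, hT, Units.val_mk0, map_add, map_one]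
        linear_combination -hu
    · rintro ⟨y, rfl⟩
      rw [hD, map_div, hTT]
      simp
  have hK : Nat.card Kˣ = (q - 1) * (q + 1) := by
    rw [Nat.card_units, Nat.card_eq_fintype_card, hq]
    obtain ⟨r, rfl⟩ := Nat.exists_eq_add_of_lt hq1
    simp only [show 1 + r + 1 - 1 = r + 1 by omega]
    exact Nat.sub_eq_of_eq_add (by ring)
  have hcard : ∀ f : Kˣ →* Kˣ, Nat.card f.ker * Nat.card f.range = (q - 1) * (q + 1) := by
    intro f
    rw [← hK, ← Subgroup.index_ker, Subgroup.card_mul_index]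
  have hkerN : Nat.card N.ker = q + 1 := by
    have := hcard D
    rw [hkerD] at this
    rw [hker]
    exact Nat.eq_of_mul_eq_mul_left (by omega) this
  have hrangeN : Nat.card N.range = q - 1 := by
    have := hcard N
    rw [hkerN, mul_comm] at this
    exact Nat.eq_of_mul_eq_mul_right (by omega) this
  have hrange : N.range = D.ker := by
    refine Subgroup.eq_of_le_of_card_ge ?_ (by rw [hrangeN, hkerD])
    rintro _ ⟨y, rfl⟩
    rw [MonoidHom.mem_ker, hD, hN, map_mul, hTT, div_eq_one, mul_comm]
  have hcN : Units.mk0 c hc0 ∈ N.range := by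
    rw [hrange, MonoidHom.mem_ker, hD, div_eq_one]
    exact Units.ext (by rw [hT]; simp [hc])
  obtain ⟨y, hy⟩ := hcN
  have hyc : (y : K) * τ y = c := by simpa [hN, hT] using congrArg Units.val hy
  have hmem : ∀ x : K, x ∈ ({t : K | t * τ t = c} : Finset K) ↔ x * τ x = c := by simp
  have hker1 : ∀ u : Kˣ, u ∈ N.ker → (u : K) * y ∈ ({t : K | t * τ t = c} : Finset K) := by
    intro u hu
    have hu : (u : K) * τ u = 1 := by
      simpa [hN, hT] using congrArg Units.val (MonoidHom.mem_ker.1 hu)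
    rw [hmem, map_mul, ← hyc]
    linear_combination (y : K) * τ y * hu
  have hne : ∀ x : K, x ∈ ({t : K | t * τ t = c} : Finset K) → x / y ≠ 0 := by
    intro x hx h
    rw [hmem] at hx
    rw [div_eq_zero_iff, or_iff_left y.ne_zero] at h
    rw [h, zero_mul] at hx
    exact hc0 hx.symm
  have hker2 : ∀ (x : K) (hx : x ∈ ({t : K | t * τ t = c} : Finset K)),
      Units.mk0 (x / y) (hne x hx) ∈ N.ker := by
    intro x hx
    rw [MonoidHom.mem_ker, hN]
    refine Units.ext ?_
    rw [Units.val_mul, hT, Units.val_mk0, map_div₀, Units.val_one, div_mul_div_comm,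
      (hmem x).1 hx, hyc, div_self hc0]
  rw [← hkerN, ← Nat.card_eq_finsetCard]
  refine (Nat.card_congr ⟨fun u => ⟨((u : Kˣ) : K) * y, hker1 u u.2⟩,
    fun x => ⟨Units.mk0 ((x : K) / y) (hne x x.2), hker2 x x.2⟩, ?_, ?_⟩).symm
  · intro u; ext; simp
  · intro u; ext; simp

end FieldInvolution

/-! ### Recursions for the number of isotropic vectors -/

section HermitianCounting

variable {K V : Type*} [Field K] [AddCommGroup V] [Module K V] {τ : K ≃+* K}
  {Ψ : V →ₗ[K] V →ₛₗ[(τ : K →+* K)] K}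

/-- The hyperplane orthogonal to `w` (all of `V` if `w` is in the radical). -/
def orthogonalTo (Ψ : V →ₗ[K] V →ₛₗ[(τ : K →+* K)] K) (w : V) : Submodule K V :=
  LinearMap.ker (Ψ.flip w)

@[simp] lemma mem_orthogonalTo {w x : V} : x ∈ orthogonalTo Ψ w ↔ Ψ x w = 0 := by
  simp [orthogonalTo]

namespace IsUnitaryForm

lemma apply_self (hΨ : IsUnitaryForm τ Ψ) (v : V) : τ (Ψ v v) = Ψ v v := (hΨ.hermitian v v).symm

lemma eq_zero_comm (hΨ : IsUnitaryForm τ Ψ) {v w : V} : Ψ v w = 0 ↔ Ψ w v = 0 := by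
  rw [hΨ.hermitian v w, map_eq_zero_iff τ τ.injective]

lemma exists_apply_ne_zero (hΨ : IsUnitaryForm τ Ψ) {w : V} (hw : w ≠ 0) : ∃ y, Ψ y w ≠ 0 := by
  by_contra! h
  exact hw (hΨ.nondegenerate.2 w h)

/-- A subspace on which the form does not vanish contains a nonisotropic vector. -/
lemma exists_apply_self_ne_zero (hΨ : IsUnitaryForm τ Ψ) {U : Submodule K V} {x y : V}
    (hx : x ∈ U) (hy : y ∈ U) (hxy : Ψ x y ≠ 0) : ∃ w ∈ U, Ψ w w ≠ 0 := by
  by_contra! h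
  obtain ⟨a, ha⟩ := exists_add_apply_ne_zero hΨ.orderOf_eq
  apply ha
  -- The scaling makes the cross terms equal to a and τ a, so isotropy of this vector would make the
  -- trace of a vanish.
  have h1 := h ((a / Ψ x y) • x + y) (U.add_mem (U.smul_mem _ hx) hy)
  simp only [map_add, map_smul, LinearMap.add_apply, LinearMap.smul_apply, map_smulₛₗ,
    smul_eq_mul, h x hx, h y hy, mul_zero, zero_add, add_zero, RingHom.coe_coe] at h1
  rw [hΨ.hermitian y x, ← map_mul, div_mul_cancel₀ _ hxy] at h1
  rw [add_comm]; exact h1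

end IsUnitaryForm

variable [Fintype K] [Fintype V] {q : ℕ}

open Classical in
/-- The number of vectors of a subspace. -/
noncomputable def vectorCount (U : Submodule K V) : ℕ := #{x : V | x ∈ U}

open Classical in
/-- The number of isotropic vectors, including zero, of a subspace. -/
noncomputable def isotropicCount (Ψ : V →ₗ[K] V →ₛₗ[(τ : K →+* K)] K) (U : Submodule K V) : ℕ :=
  #{x : V | x ∈ U ∧ Ψ x x = 0}

lemma vectorCount_inf_orthogonalTo (hq : Fintype.card K = q ^ 2)
    {U : Submodule K V} {w y : V} (hy : y ∈ U) (hyw : Ψ y w ≠ 0) :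
    vectorCount U = q ^ 2 * vectorCount (U ⊓ orthogonalTo Ψ w) := by
  classical
  rw [vectorCount, vectorCount, mul_comm, ← hq, ← card_univ, ← card_product]
  symm
  refine Finset.card_bij' (fun p _ => p.1 + p.2 • y)
    (fun x _ => (x - (Ψ x w / Ψ y w) • y, Ψ x w / Ψ y w)) ?_ ?_ ?_ ?_
  · rintro ⟨x, c⟩ h
    simp only [mem_product, mem_filter, mem_univ, true_and, and_true, Submodule.mem_inf] at h ⊢
    exact U.add_mem h.1 (U.smul_mem _ hy)
  · intro x h
    simp only [mem_product, mem_filter, mem_univ, true_and, and_true, Submodule.mem_inf,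
      mem_orthogonalTo] at h ⊢
    refine ⟨U.sub_mem h (U.smul_mem _ hy), ?_⟩
    simp [hyw]
  · rintro ⟨x, c⟩ h
    simp only [mem_product, mem_filter, mem_univ, true_and, and_true, Submodule.mem_inf,
      mem_orthogonalTo] at h
    simp [h.2, hyw]
  · intro x h
    simp

/-- Each x in U is uniquely y + c w with y orthogonal to w, and Ψ x x = Ψ y y + c τ(c) Ψ w w. The
number of c making this vanish is 1 if y is isotropic and q + 1 otherwise. -/
lemma isotropicCount_of_apply_self_ne_zero (hΨ : IsUnitaryForm τ Ψ)
    (hq : Fintype.card K = q ^ 2) {U : Submodule K V} {w : V} (hw : w ∈ U) (hww : Ψ w w ≠ 0) :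
    isotropicCount Ψ U + q * isotropicCount Ψ (U ⊓ orthogonalTo Ψ w) =
      (q + 1) * vectorCount (U ⊓ orthogonalTo Ψ w) := by
  classical
  set U' := U ⊓ orthogonalTo Ψ w with hU'
  have hmem : ∀ x, x ∈ U' ↔ x ∈ U ∧ Ψ x w = 0 := fun x => by simp [hU']
  have hQ : ∀ y, y ∈ U' → ∀ c : K, Ψ (y + c • w) (y + c • w) = Ψ y y + c * τ c * Ψ w w := by
    intro y hy c
    have h1 := ((hmem y).1 hy).2
    have h2 := hΨ.eq_zero_comm.1 h1
    simp only [map_add, map_smul, LinearMap.add_apply, LinearMap.smul_apply, map_smulₛₗ,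
      smul_eq_mul, h1, h2, mul_zero, zero_add, add_zero, RingHom.coe_coe]
    ring
  have key : isotropicCount Ψ U =
      ∑ y : V with y ∈ U', #{c : K | c * τ c = -Ψ y y / Ψ w w} := by
    rw [isotropicCount, ← card_sigma]
    symm
    have hiff : ∀ y c, c * τ c = -Ψ y y / Ψ w w ↔ Ψ y y + c * τ c * Ψ w w = 0 := by
      intro y c
      rw [eq_div_iff hww, eq_neg_iff_add_eq_zero, add_comm]
    refine Finset.card_bij' (fun p _ => p.1 + p.2 • w)
      (fun x _ => ⟨x - (Ψ x w / Ψ w w) • w, Ψ x w / Ψ w w⟩) ?_ ?_ ?_ ?_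
    · rintro ⟨y, c⟩ h
      simp only [mem_sigma, mem_filter, mem_univ, true_and] at h ⊢
      refine ⟨U.add_mem ((hmem y).1 h.1).1 (U.smul_mem _ hw), ?_⟩
      rw [hQ y h.1, ← hiff]
      exact h.2
    · intro x h
      simp only [mem_sigma, mem_filter, mem_univ, true_and] at h ⊢
      have hy : x - (Ψ x w / Ψ w w) • w ∈ U' := by
        rw [hmem]
        exact ⟨U.sub_mem h.1 (U.smul_mem _ hw), by simp [hww]⟩
      refine ⟨hy, ?_⟩
      rw [hiff, ← hQ _ hy, sub_add_cancel]
      exact h.2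
    · rintro ⟨y, c⟩ h
      simp only [mem_sigma, mem_filter, mem_univ, true_and] at h
      simp [((hmem y).1 h.1).2, hww]
    · intro x h
      simp
  have hfib : ∀ y, #{c : K | c * τ c = -Ψ y y / Ψ w w} + q * (if Ψ y y = 0 then 1 else 0) =
      q + 1 := by
    intro y
    split_ifs with h
    · have : ({c : K | c * τ c = -Ψ y y / Ψ w w} : Finset K) = {0} := by
        ext c; simp [h]
      rw [this, card_singleton]
      omega
    · rw [card_norm_fiber hΨ.orderOf_eq hq]
      · simp
      · simp [map_div₀, hΨ.apply_self]
      · exact div_ne_zero (neg_ne_zero.2 h) hww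
  have hiso : isotropicCount Ψ U' = ∑ y : V with y ∈ U', if Ψ y y = 0 then 1 else 0 := by
    rw [isotropicCount, ← filter_filter, card_filter]
  rw [key, hiso, mul_sum, ← sum_add_distrib, sum_congr rfl fun y _ => hfib y, sum_const,
    smul_eq_mul, vectorCount, mul_comm]

/-- Off w^⊥, replacing x by x + t w changes Ψ x x by the trace of t Ψ w x, so exactly q of the q²
translates are isotropic. Double counting shows that a fraction 1/q of U outside w^⊥ is isotropic.
-/
lemma isotropicCount_of_apply_self_eq_zero (hΨ : IsUnitaryForm τ Ψ)
    (hq : Fintype.card K = q ^ 2) {U : Submodule K V} {w : V} (hw : w ∈ U) (hww : Ψ w w = 0) :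
    q * isotropicCount Ψ U + vectorCount (U ⊓ orthogonalTo Ψ w) =
      vectorCount U + q * isotropicCount Ψ (U ⊓ orthogonalTo Ψ w) := by
  classical
  have hq0 : 0 < q := zero_lt_one.trans (one_lt_of_card_eq_sq hq)
  set D : Finset V := {x | x ∈ U ∧ Ψ x w ≠ 0} with hD
  have hQ : ∀ x (t : K), Ψ (x + t • w) (x + t • w) = Ψ x x + (t * Ψ w x + τ (t * Ψ w x)) := by
    intro x t
    simp only [map_add, map_smul, LinearMap.add_apply, LinearMap.smul_apply, map_smulₛₗ,
      smul_eq_mul, hww, mul_zero, add_zero, RingHom.coe_coe, map_mul, ← hΨ.hermitian]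
    ring
  have h1 : ∀ x ∈ D, #{t : K | Ψ (x + t • w) (x + t • w) = 0} = q := by
    intro x hx
    have hk : Ψ w x ≠ 0 := fun h => (mem_filter.1 hx).2.2 (hΨ.eq_zero_comm.1 h)
    rw [← card_trace_fiber (τ := τ) hΨ.orderOf_eq hq (c := -Ψ x x) (by simp [hΨ.apply_self]) hk]
    congr 1
    ext t
    simp only [mem_filter, mem_univ, true_and, hQ, eq_neg_iff_add_eq_zero]
    rw [add_comm]
  have h2 : ∀ t : K, #{x ∈ D | Ψ (x + t • w) (x + t • w) = 0} = #{x ∈ D | Ψ x x = 0} := by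
    intro t
    have hDt : ∀ (s : K) x, x ∈ D → x + s • w ∈ D := by
      intro s x hx
      simp only [hD, mem_filter, mem_univ, true_and] at hx ⊢
      refine ⟨U.add_mem hx.1 (U.smul_mem _ hw), ?_⟩
      simpa [hww] using hx.2
    refine Finset.card_bij' (fun x _ => x + t • w) (fun x _ => x + (-t) • w) ?_ ?_ ?_ ?_
    · intro x hx
      rw [mem_filter] at hx ⊢
      exact ⟨hDt _ _ hx.1, hx.2⟩
    · intro x hx
      rw [mem_filter] at hx ⊢
      refine ⟨hDt _ _ hx.1, ?_⟩
      simpa using hx.2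
    · intro x _; simp
    · intro x _; simp
  have h3 : q * #{x ∈ D | Ψ x x = 0} = #D := by
    have := sum_card_bipartiteAbove_eq_sum_card_bipartiteBelow (s := D) (t := (univ : Finset K))
      (fun x t => Ψ (x + t • w) (x + t • w) = 0)
    simp only [bipartiteAbove, bipartiteBelow] at this
    rw [sum_congr rfl h1, sum_congr rfl fun t _ => h2 t, sum_const, sum_const, card_univ, hq,
      smul_eq_mul, smul_eq_mul] at this
    refine Nat.eq_of_mul_eq_mul_right hq0 ?_
    rw [this]; ring
  have h4 : vectorCount U = vectorCount (U ⊓ orthogonalTo Ψ w) + #D := by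
    rw [vectorCount, ← card_filter_add_card_filter_not (s := {x : V | x ∈ U}) (fun x => Ψ x w = 0),
      filter_filter, filter_filter, vectorCount]
    simp [hD]
  have h5 : isotropicCount Ψ U =
      isotropicCount Ψ (U ⊓ orthogonalTo Ψ w) + #{x ∈ D | Ψ x x = 0} := by
    rw [isotropicCount,
      ← card_filter_add_card_filter_not (s := {x : V | x ∈ U ∧ Ψ x x = 0}) (fun x => Ψ x w = 0),
      filter_filter, filter_filter, isotropicCount, hD, filter_filter]
    simp only [Submodule.mem_inf, mem_orthogonalTo, and_assoc, and_comm, and_left_comm, ne_eq]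
  rw [h4, h5, ← h3]
  ring

/-- The number of isotropic vectors of a nondegenerate subspace. -/
theorem isotropicCount_of_nondegenerate (hΨ : IsUnitaryForm τ Ψ) (hq : Fintype.card K = q ^ 2)
    (m : ℕ) (U : Submodule K V) (hU : ∀ x ∈ U, (∀ y ∈ U, Ψ y x = 0) → x = 0)
    (hm : vectorCount U = q ^ (2 * m)) :
    (q : ℝ) * isotropicCount Ψ U = q ^ (2 * m) + (q - 1) * (-q) ^ m := by
  classical
  induction m generalizing U with
  | zero =>
    have h1 : isotropicCount Ψ U = 1 := by
      refine le_antisymm ?_ ?_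
      · rw [mul_zero, pow_zero] at hm
        rw [← hm]
        exact card_le_card fun x hx => by
          simp only [mem_filter, mem_univ, true_and] at hx ⊢; exact hx.1
      · exact card_pos.2 ⟨0, by simp⟩
    simp [h1]
  | succ m ih =>
    have hq1 : 1 < q := one_lt_of_card_eq_sq hq
    obtain ⟨x, hx, hx0⟩ : ∃ x ∈ U, x ≠ 0 := by
      by_contra! h
      have : vectorCount U ≤ 1 := by
        rw [vectorCount, card_le_one]
        intro a ha b hb
        simp only [mem_filter, mem_univ, true_and] at ha hb
        rw [h a ha, h b hb]
      rw [hm] at this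
      exact absurd (Nat.one_lt_pow (by omega : 2 * (m + 1) ≠ 0) hq1) (by omega)
    obtain ⟨y, hy, hyx⟩ : ∃ y ∈ U, Ψ y x ≠ 0 := by
      by_contra! h
      exact hx0 (hU x hx h)
    -- The complement of w in U is again nondegenerate, since projecting along w loses nothing
    -- against vectors of w^⊥; this drives the induction.
    obtain ⟨w, hw, hww⟩ := hΨ.exists_apply_self_ne_zero hy hx hyx
    have hc := vectorCount_inf_orthogonalTo (Ψ := Ψ) hq hw hww
    have hc' : vectorCount (U ⊓ orthogonalTo Ψ w) = q ^ (2 * m) := by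
      refine Nat.eq_of_mul_eq_mul_left (pow_pos (by omega : 0 < q) 2) ?_
      rw [← hc, hm]; ring
    have hi := isotropicCount_of_apply_self_ne_zero hΨ hq hw hww
    have hrec := ih (U ⊓ orthogonalTo Ψ w) ?_ hc'
    · rw [hc'] at hi
      have hi' := congrArg (Nat.cast (R := ℝ)) hi
      push_cast at hi'
      linear_combination (q : ℝ) * hi' - (q : ℝ) * hrec
    · intro a ha h
      rw [Submodule.mem_inf, mem_orthogonalTo] at ha
      refine hU a ha.1 fun y hy => ?_
      have h1 := h (y - (Ψ y w / Ψ w w) • w) ?_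
      · simpa [hΨ.eq_zero_comm.1 ha.2] using h1
      · rw [Submodule.mem_inf, mem_orthogonalTo]
        exact ⟨U.sub_mem hy (U.smul_mem _ hw), by simp [hww]⟩

end HermitianCounting

/-! ### Counts in v^⊥ and v^⊥ ∩ u^⊥ -/

section PerpCounts

variable {K V : Type*} [Field K] [AddCommGroup V] [Module K V] {τ : K ≃+* K}
  {Ψ : V →ₗ[K] V →ₛₗ[(τ : K →+* K)] K}

/-- Lets u be replaced by its projection to v^⊥, so that the recursions apply inside v^⊥. -/
lemma orthogonalTo_inf_sub_smul (u v : V) (c : K) :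
    orthogonalTo Ψ v ⊓ orthogonalTo Ψ (u - c • v) = orthogonalTo Ψ v ⊓ orthogonalTo Ψ u := by
  ext x
  simp only [Submodule.mem_inf, mem_orthogonalTo, map_sub, map_smulₛₗ, smul_eq_mul]
  exact and_congr_right fun h => by simp [h]

lemma sub_smul_mem_orthogonalTo (u : V) {v : V} (hv : Ψ v v ≠ 0) :
    u - (Ψ u v / Ψ v v) • v ∈ orthogonalTo Ψ v := by
  simp [hv]

/-- The numerator is the Gram determinant of u and v: the projection is isotropic exactly when that
determinant vanishes, which selects the recursion to use. -/
lemma apply_sub_smul_self (u : V) {v : V} (hv : Ψ v v ≠ 0) :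
    Ψ (u - (Ψ u v / Ψ v v) • v) (u - (Ψ u v / Ψ v v) • v) =
      (Ψ u u * Ψ v v - Ψ u v * Ψ v u) / Ψ v v := by
  have h := mem_orthogonalTo.1 (sub_smul_mem_orthogonalTo u hv)
  rw [map_sub (Ψ (u - (Ψ u v / Ψ v v) • v)), map_smulₛₗ, h, smul_zero, sub_zero, map_sub,
    LinearMap.sub_apply, map_smul, LinearMap.smul_apply, smul_eq_mul]
  field_simp

lemma vectorCount_top [Fintype V] : vectorCount (⊤ : Submodule K V) = Fintype.card V := by
  simp [vectorCount]

variable [Fintype K] [Fintype V] {q k : ℕ}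

lemma vectorCount_orthogonalTo (hq : Fintype.card K = q ^ 2)
    (hV : Fintype.card V = q ^ (2 * (k + 2))) {v : V} (hv : Ψ v v ≠ 0) :
    vectorCount (orthogonalTo Ψ v) = q ^ (2 * (k + 1)) := by
  have hq0 : 0 < q ^ 2 := hq ▸ Fintype.card_pos
  have h := vectorCount_inf_orthogonalTo (Ψ := Ψ) hq (Submodule.mem_top (x := v)) hv
  rw [top_inf_eq, vectorCount_top, hV] at h
  refine Nat.eq_of_mul_eq_mul_left hq0 ?_
  rw [← h]; ring

lemma isotropicCount_orthogonalTo (hΨ : IsUnitaryForm τ Ψ) (hq : Fintype.card K = q ^ 2)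
    (hV : Fintype.card V = q ^ (2 * (k + 2))) {v : V} (hv : Ψ v v ≠ 0) :
    (isotropicCount Ψ (orthogonalTo Ψ v) : ℝ) =
      q * (q ^ k) ^ 2 - (q - 1) * (-1) ^ k * q ^ k := by
  have hq0 : 0 < q := zero_lt_one.trans (one_lt_of_card_eq_sq hq)
  have hq0' : (q : ℝ) ≠ 0 := by positivity
  have h := isotropicCount_of_apply_self_ne_zero hΨ hq (Submodule.mem_top (x := v)) hv
  have htop := isotropicCount_of_nondegenerate hΨ hq (k + 2) ⊤
    (fun x _ hx => hΨ.nondegenerate.2 x fun y => hx y trivial) (by rw [vectorCount_top, hV])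
  rw [top_inf_eq, vectorCount_orthogonalTo hq hV hv] at h
  have h' := congrArg (Nat.cast (R := ℝ)) h
  push_cast at h'
  rw [neg_pow] at htop
  refine mul_left_cancel₀ (pow_ne_zero 2 hq0') ?_
  linear_combination (q : ℝ) * h' - htop

/-- A nonzero projection of u is not orthogonal to all of v^⊥, by nondegeneracy, so it cuts out a
hyperplane of v^⊥ even when it is isotropic. -/
lemma vectorCount_orthogonalTo_inf (hΨ : IsUnitaryForm τ Ψ) (hq : Fintype.card K = q ^ 2)
    (hV : Fintype.card V = q ^ (2 * (k + 2))) {u v : V} (hv : Ψ v v ≠ 0)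
    (huv : u - (Ψ u v / Ψ v v) • v ≠ 0) :
    vectorCount (orthogonalTo Ψ v ⊓ orthogonalTo Ψ u) = q ^ (2 * k) ∧
      ∃ y ∈ orthogonalTo Ψ v, Ψ y (u - (Ψ u v / Ψ v v) • v) ≠ 0 := by
  set w := u - (Ψ u v / Ψ v v) • v with hw
  have hwv : w ∈ orthogonalTo Ψ v := sub_smul_mem_orthogonalTo u hv
  obtain ⟨y, hy⟩ := hΨ.exists_apply_ne_zero huv
  have hy' : Ψ (y - (Ψ y v / Ψ v v) • v) w ≠ 0 := by
    have := hΨ.eq_zero_comm.1 (mem_orthogonalTo.1 hwv)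
    simpa [this] using hy
  have hyv := sub_smul_mem_orthogonalTo y hv
  refine ⟨?_, _, hyv, hy'⟩
  have hq0 : 0 < q ^ 2 := hq ▸ Fintype.card_pos
  have h := vectorCount_inf_orthogonalTo hq hyv hy'
  rw [hw, orthogonalTo_inf_sub_smul, vectorCount_orthogonalTo hq hV hv] at h
  refine Nat.eq_of_mul_eq_mul_left hq0 ?_
  rw [← h]; ring

/-- Isotropic vectors orthogonal to both vectors spanning a nondegenerate plane. -/
lemma isotropicCount_orthogonalTo_inf_of_ne (hΨ : IsUnitaryForm τ Ψ)
    (hq : Fintype.card K = q ^ 2) (hV : Fintype.card V = q ^ (2 * (k + 2))) {u v : V}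
    (hv : Ψ v v ≠ 0) (huv : Ψ u v * Ψ v u ≠ Ψ u u * Ψ v v) :
    (isotropicCount Ψ (orthogonalTo Ψ v ⊓ orthogonalTo Ψ u) : ℝ) =
      (q ^ k) ^ 2 / q + (q - 1) * (-1) ^ k * q ^ k / q := by
  have hq0 : 0 < q := zero_lt_one.trans (one_lt_of_card_eq_sq hq)
  have hq0' : (q : ℝ) ≠ 0 := by positivity
  have hw := apply_sub_smul_self (Ψ := Ψ) u hv
  have hw0 : Ψ (u - (Ψ u v / Ψ v v) • v) (u - (Ψ u v / Ψ v v) • v) ≠ 0 := by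
    rw [hw]; exact div_ne_zero (sub_ne_zero.2 huv.symm) hv
  have h := isotropicCount_of_apply_self_ne_zero hΨ hq (sub_smul_mem_orthogonalTo u hv) hw0
  have hne : u - (Ψ u v / Ψ v v) • v ≠ 0 := fun h0 => hw0 (by rw [h0, map_zero])
  rw [orthogonalTo_inf_sub_smul, (vectorCount_orthogonalTo_inf hΨ hq hV hv hne).1] at h
  have h' := congrArg (Nat.cast (R := ℝ)) h
  push_cast at h'
  rw [isotropicCount_orthogonalTo hΨ hq hV hv] at h'
  refine mul_left_cancel₀ hq0' ?_
  field_simp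
  linear_combination h'

/-- Isotropic vectors orthogonal to both vectors spanning a degenerate plane. -/
lemma isotropicCount_orthogonalTo_inf_of_eq (hΨ : IsUnitaryForm τ Ψ)
    (hq : Fintype.card K = q ^ 2) (hV : Fintype.card V = q ^ (2 * (k + 2))) {u v : V}
    (hv : Ψ v v ≠ 0) (huv : Ψ u v * Ψ v u = Ψ u u * Ψ v v)
    (hne : u - (Ψ u v / Ψ v v) • v ≠ 0) :
    (isotropicCount Ψ (orthogonalTo Ψ v ⊓ orthogonalTo Ψ u) : ℝ) =
      (q ^ k) ^ 2 / q - (q - 1) * (-1) ^ k * q ^ k := by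
  have hq0 : 0 < q := zero_lt_one.trans (one_lt_of_card_eq_sq hq)
  have hq0' : (q : ℝ) ≠ 0 := by positivity
  have hw := apply_sub_smul_self (Ψ := Ψ) u hv
  rw [huv, sub_self, zero_div] at hw
  have h := isotropicCount_of_apply_self_eq_zero hΨ hq (sub_smul_mem_orthogonalTo u hv) hw
  rw [orthogonalTo_inf_sub_smul, (vectorCount_orthogonalTo_inf hΨ hq hV hv hne).1,
    vectorCount_orthogonalTo hq hV hv] at h
  have h' := congrArg (Nat.cast (R := ℝ)) h
  push_cast at h'
  rw [isotropicCount_orthogonalTo hΨ hq hV hv] at h'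
  refine mul_left_cancel₀ hq0' ?_
  field_simp
  linear_combination -h'

open Classical in
/-- The isotropic vectors of `U` off the hyperplane `u^⊥` are distributed evenly over the nonzero
values of `Ψ · u`. -/
lemma card_isotropic_apply_eq (hq : Fintype.card K = q ^ 2) (U : Submodule K V) (u : V) {c : K}
    (hc : c ≠ 0) :
    (q ^ 2 - 1) * #{r : V | (r ∈ U ∧ Ψ r r = 0) ∧ Ψ r u = c} +
      isotropicCount Ψ (U ⊓ orthogonalTo Ψ u) = isotropicCount Ψ U := by
  have h1 : (q ^ 2 - 1) * #{r : V | (r ∈ U ∧ Ψ r r = 0) ∧ Ψ r u = c} =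
      #{r : V | (r ∈ U ∧ Ψ r r = 0) ∧ ¬ Ψ r u = 0} := by
    have : q ^ 2 - 1 = #((univ : Finset K).erase 0) := by
      rw [card_erase_of_mem (mem_univ _), card_univ, hq]
    rw [this, ← card_product]
    refine Finset.card_bij' (fun p _ => p.1 • p.2)
      (fun r _ => (Ψ r u / c, (c / Ψ r u) • r)) ?_ ?_ ?_ ?_
    · rintro ⟨a, r⟩ h
      simp only [mem_product, mem_erase, mem_univ, and_true, mem_filter, true_and] at h ⊢
      refine ⟨⟨U.smul_mem _ h.2.1.1, by simp [h.2.1.2]⟩, ?_⟩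
      simp [h.1, h.2.2, hc]
    · intro r h
      simp only [mem_product, mem_erase, mem_univ, and_true, mem_filter, true_and] at h ⊢
      refine ⟨div_ne_zero h.2 hc, ⟨U.smul_mem _ h.1.1, by simp [h.1.2]⟩, by simp [h.2]⟩
    · rintro ⟨a, r⟩ h
      simp only [mem_product, mem_erase, mem_univ, and_true, mem_filter, true_and] at h
      have ha := h.1
      simp only [map_smul, LinearMap.smul_apply, smul_eq_mul, h.2.2, Prod.mk.injEq, smul_smul]
      constructor
      · field_simp
      · rw [show c / (a * c) * a = 1 by field_simp, one_smul]
    · intro r h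
      simp only [mem_filter, mem_univ, true_and] at h
      have h2 := h.2
      simp only [smul_smul]
      rw [show Ψ r u / c * (c / Ψ r u) = 1 by field_simp, one_smul]
  rw [h1, isotropicCount, isotropicCount,
    ← card_filter_add_card_filter_not (s := {x : V | x ∈ U ∧ Ψ x x = 0}) (fun x => Ψ x u = 0),
    filter_filter, filter_filter, add_comm]
  simp only [Submodule.mem_inf, mem_orthogonalTo, and_assoc, and_comm, and_left_comm]

end PerpCounts

/-! ### Vertices, spanning vectors and tangency -/

section Vertices

variable {K V : Type*} [Field K] [AddCommGroup V] [Module K V] {τ : K ≃+* K}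
  {Ψ : V →ₗ[K] V →ₛₗ[(τ : K →+* K)] K}

lemma isNondegenerateSubspace_span_singleton {v : V} (hv : Ψ v v ≠ 0) :
    IsNondegenerateSubspace Ψ (K ∙ v) := by
  have hmem : v ∈ K ∙ v := Submodule.mem_span_singleton_self v
  constructor
  · rintro ⟨x, hx⟩ h
    obtain ⟨c, rfl⟩ := Submodule.mem_span_singleton.1 hx
    have h1 : Ψ (c • v) v = 0 := h ⟨v, hmem⟩
    rw [map_smul, LinearMap.smul_apply, smul_eq_mul, mul_eq_zero, or_iff_left hv] at h1
    simp [h1]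
  · rintro ⟨x, hx⟩ h
    obtain ⟨c, rfl⟩ := Submodule.mem_span_singleton.1 hx
    have h1 : Ψ v (c • v) = 0 := h ⟨v, hmem⟩
    rw [map_smulₛₗ, smul_eq_mul, mul_eq_zero, or_iff_left hv, RingHom.coe_coe,
      map_eq_zero_iff τ τ.injective] at h1
    simp [h1]

namespace FrameVertex

/-- The vertex spanned by a nonisotropic vector. -/
def span (v : V) (hv : Ψ v v ≠ 0) : FrameVertex Ψ :=
  ⟨K ∙ v, finrank_span_singleton fun h => hv (by rw [h, map_zero]),
    isNondegenerateSubspace_span_singleton hv⟩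

lemma exists_rep (P : FrameVertex Ψ) : ∃ v, Ψ v v ≠ 0 ∧ P.1 = K ∙ v := by
  obtain ⟨⟨v, hv⟩, hv0, hspan⟩ := finrank_eq_one_iff'.1 P.2.1
  have hP : P.1 = K ∙ v := by
    apply le_antisymm
    · intro x hx
      obtain ⟨c, hc⟩ := hspan ⟨x, hx⟩
      exact Submodule.mem_span_singleton.2 ⟨c, congrArg Subtype.val hc⟩
    · rwa [Submodule.span_singleton_le_iff_mem]
  refine ⟨v, fun h => hv0 (P.2.2.1 _ ?_), hP⟩
  rintro ⟨y, hy⟩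
  rw [hP] at hy
  obtain ⟨c, rfl⟩ := Submodule.mem_span_singleton.1 hy
  change Ψ v (c • v) = 0
  rw [map_smulₛₗ, h, smul_zero]

/-- A vector spanning a vertex. -/
noncomputable def rep (P : FrameVertex Ψ) : V := P.exists_rep.choose

lemma rep_self_ne_zero (P : FrameVertex Ψ) : Ψ P.rep P.rep ≠ 0 := P.exists_rep.choose_spec.1

lemma rep_ne_zero (P : FrameVertex Ψ) : P.rep ≠ 0 := fun h =>
  P.rep_self_ne_zero (by rw [h, map_zero])

lemma eq_span_rep (P : FrameVertex Ψ) : P.1 = K ∙ P.rep := P.exists_rep.choose_spec.2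

lemma ext_of_rep_mem {P R : FrameVertex Ψ} {c : K} (h : P.rep = c • R.rep) : P = R := by
  apply Subtype.ext
  have hc : c ≠ 0 := by rintro rfl; exact P.rep_ne_zero (by rw [h, zero_smul])
  rw [P.eq_span_rep, R.eq_span_rep, h, Submodule.span_singleton_smul_eq hc.isUnit]

lemma exists_rep_span (v : V) (hv : Ψ v v ≠ 0) :
    ∃ c : K, c ≠ 0 ∧ (span v hv : FrameVertex Ψ).rep = c • v := by
  have h : (span v hv : FrameVertex Ψ).rep ∈ K ∙ v := by
    change _ ∈ (span v hv : FrameVertex Ψ).1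
    rw [eq_span_rep]
    exact Submodule.mem_span_singleton_self _
  obtain ⟨c, hc⟩ := Submodule.mem_span_singleton.1 h
  refine ⟨c, ?_, hc.symm⟩
  rintro rfl
  exact rep_ne_zero _ (by rw [← hc, zero_smul])

lemma span_eq_of_eq_smul {v : V} (hv : Ψ v v ≠ 0) {P : FrameVertex Ψ} {c : K}
    (h : v = c • P.rep) : span v hv = P := by
  obtain ⟨a, -, ha⟩ := exists_rep_span v hv
  exact ext_of_rep_mem (c := a * c) (by rw [ha, h, smul_smul])

/-- Two vertices coincide or span a degenerate plane: the Gram determinant vanishes. -/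
def Tangent (P R : FrameVertex Ψ) : Prop :=
  Ψ P.rep R.rep * Ψ R.rep P.rep = Ψ P.rep P.rep * Ψ R.rep R.rep

lemma tangent_self (P : FrameVertex Ψ) : P.Tangent P := rfl

lemma Tangent.symm {P R : FrameVertex Ψ} (h : P.Tangent R) : R.Tangent P := by
  unfold Tangent at *
  rw [mul_comm, h, mul_comm]

lemma tangent_comm {P R : FrameVertex Ψ} : P.Tangent R ↔ R.Tangent P :=
  ⟨Tangent.symm, Tangent.symm⟩

lemma Tangent.apply_ne_zero {P R : FrameVertex Ψ} (h : P.Tangent R) : Ψ P.rep R.rep ≠ 0 := by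
  intro h0
  unfold Tangent at h
  rw [h0, zero_mul] at h
  exact mul_ne_zero P.rep_self_ne_zero R.rep_self_ne_zero h.symm

/-- Rescaling a spanning vector by c multiplies both sides of the Gram equation by c τ(c), so any
spanning vector may be used. -/
lemma tangent_span_iff {v : V} (hv : Ψ v v ≠ 0) (R : FrameVertex Ψ) :
    (span v hv).Tangent R ↔ Ψ v R.rep * Ψ R.rep v = Ψ v v * Ψ R.rep R.rep := by
  obtain ⟨c, hc, h⟩ := exists_rep_span v hv
  unfold Tangent
  rw [h]
  simp only [map_smul, map_smulₛₗ, LinearMap.smul_apply, smul_eq_mul, RingHom.coe_coe]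
  have hc' : τ c ≠ 0 := (map_ne_zero τ).2 hc
  rw [show c * Ψ v R.rep * (τ c * Ψ R.rep v) = c * τ c * (Ψ v R.rep * Ψ R.rep v) by ring,
    show τ c * (c * Ψ v v) * Ψ R.rep R.rep = c * τ c * (Ψ v v * Ψ R.rep R.rep) by ring]
  exact mul_right_inj' (mul_ne_zero hc hc')

lemma rep_sub_smul_eq_zero_iff {P R : FrameVertex Ψ} :
    P.rep - (Ψ P.rep R.rep / Ψ R.rep R.rep) • R.rep = 0 ↔ P = R := by
  constructor
  · intro h
    exact ext_of_rep_mem (sub_eq_zero.1 h)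
  · rintro rfl
    rw [div_self P.rep_self_ne_zero, one_smul, sub_self]

lemma adj_iff (hΨ : IsUnitaryForm τ Ψ) {P R : FrameVertex Ψ} :
    (frameGraph hΨ).Adj P R ↔ Ψ P.rep R.rep = 0 := by
  change (∀ v ∈ P.1, ∀ w ∈ R.1, Ψ v w = 0) ↔ _
  rw [P.eq_span_rep, R.eq_span_rep]
  constructor
  · intro h
    exact h _ (Submodule.mem_span_singleton_self _) _ (Submodule.mem_span_singleton_self _)
  · intro h v hv w hw
    obtain ⟨a, rfl⟩ := Submodule.mem_span_singleton.1 hv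
    obtain ⟨b, rfl⟩ := Submodule.mem_span_singleton.1 hw
    simp [h]

end FrameVertex

open FrameVertex

variable [Fintype K] [Fintype V] [FiniteDimensional K V] {q : ℕ}

open Classical in
/-- Each vertex in `U` accounts for `q ^ 2 - 1` nonisotropic vectors of `U`. -/
lemma card_rep_mem (hq : Fintype.card K = q ^ 2) (U : Submodule K V) :
    (q ^ 2 - 1) * #{P : FrameVertex Ψ | P.rep ∈ U} + isotropicCount Ψ U = vectorCount U := by
  have h1 : (q ^ 2 - 1) * #{P : FrameVertex Ψ | P.rep ∈ U} = #{x : V | x ∈ U ∧ ¬ Ψ x x = 0} := by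
    have : q ^ 2 - 1 = #((univ : Finset K).erase 0) := by
      rw [card_erase_of_mem (mem_univ _), card_univ, hq]
    rw [this, ← card_product]
    refine Finset.card_bij (fun p _ => p.1 • p.2.rep) ?_ ?_ ?_
    · rintro ⟨c, P⟩ h
      simp only [mem_product, mem_erase, mem_univ, and_true, mem_filter, true_and] at h ⊢
      refine ⟨U.smul_mem _ h.2, ?_⟩
      simp [h.1, P.rep_self_ne_zero]
    · rintro ⟨c, P⟩ h ⟨c', P'⟩ h' heq
      simp only [mem_product, mem_erase, mem_univ, and_true, mem_filter, true_and] at h h' heq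
      have hP : P = P' := by
        refine ext_of_rep_mem (c := c⁻¹ * c') ?_
        rw [← smul_smul, ← heq, smul_smul, inv_mul_cancel₀ h.1, one_smul]
      subst hP
      rw [smul_left_injective K P.rep_ne_zero heq]
    · intro x hx
      simp only [mem_filter, mem_univ, true_and] at hx
      obtain ⟨c, hc, h⟩ := exists_rep_span x hx.2
      refine ⟨(c⁻¹, span x hx.2), ?_, ?_⟩
      · simp only [mem_product, mem_erase, mem_univ, and_true, mem_filter, true_and]
        exact ⟨inv_ne_zero hc, h ▸ U.smul_mem _ hx.1⟩
      · simp only [h, smul_smul, inv_mul_cancel₀ hc, one_smul]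
  rw [h1, isotropicCount, vectorCount,
    ← card_filter_add_card_filter_not (s := {x : V | x ∈ U}) (fun x => Ψ x x = 0),
    filter_filter, filter_filter, add_comm]

open Classical in
/-- The vertices orthogonal to `P` and on a tangent line through `R` are the `v + r`, for `v`
spanning `R` and suitable isotropic `r` in `v^⊥`. -/
lemma card_orthogonal_tangent (hΨ : IsUnitaryForm τ Ψ) (P R : FrameVertex Ψ) :
    #{S : FrameVertex Ψ | Ψ S.rep P.rep = 0 ∧ S.Tangent R} =
      #{r : V | (r ∈ orthogonalTo Ψ R.rep ∧ Ψ r r = 0) ∧ Ψ r P.rep = -Ψ R.rep P.rep} := by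
  set v := R.rep with hv
  have hvv : Ψ v v ≠ 0 := R.rep_self_ne_zero
  have hself : ∀ r, Ψ r v = 0 → Ψ r r = 0 → Ψ (v + r) (v + r) = Ψ v v := by
    intro r h1 h2
    simp [h1, h2, hΨ.eq_zero_comm.1 h1]
  have hne : ∀ r ∈ ({r : V | (r ∈ orthogonalTo Ψ v ∧ Ψ r r = 0) ∧ Ψ r P.rep = -Ψ v P.rep} :
      Finset V), Ψ (v + r) (v + r) ≠ 0 := by
    intro r h
    simp only [mem_filter, mem_univ, true_and, mem_orthogonalTo] at h
    rwa [hself r h.1.1 h.1.2]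
  symm
  refine Finset.card_bij (fun r h => span (v + r) (hne r h)) ?_ ?_ ?_
  · intro r h
    have hr := h
    simp only [mem_filter, mem_univ, true_and, mem_orthogonalTo] at hr ⊢
    obtain ⟨c, -, h⟩ := exists_rep_span (v + r) (hne r h)
    rw [tangent_span_iff, h, hself r hr.1.1 hr.1.2]
    refine ⟨by simp [hr.2], ?_⟩
    simp [← hv, hr.1.1, hΨ.eq_zero_comm.1 hr.1.1]
  · intro r h r' h' heq
    have hr := h
    have hr' := h'
    simp only [mem_filter, mem_univ, true_and, mem_orthogonalTo] at hr hr'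
    have hmem : v + r ∈ K ∙ (v + r') := by
      have := congrArg Subtype.val heq
      change K ∙ (v + r) = K ∙ (v + r') at this
      rw [← this]
      exact Submodule.mem_span_singleton_self _
    obtain ⟨a, ha⟩ := Submodule.mem_span_singleton.1 hmem
    -- Pairing with v forces a = 1, because r and r' lie in v^⊥.
    have h1 := congrArg (fun x => Ψ x v) ha
    simp only [map_smul, map_add, LinearMap.smul_apply, LinearMap.add_apply, hr.1.1, hr'.1.1,
      add_zero, smul_eq_mul] at h1
    rw [mul_eq_right₀ hvv] at h1
    rw [h1, one_smul] at ha
    exact (add_left_cancel ha).symm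
  · intro S hS
    simp only [mem_filter, mem_univ, true_and] at hS
    have hsv : Ψ S.rep v ≠ 0 := hS.2.apply_ne_zero
    have hvs : Ψ v S.rep ≠ 0 := hS.2.symm.apply_ne_zero
    have hT : Ψ S.rep v * Ψ v S.rep = Ψ S.rep S.rep * Ψ v v := hS.2
    have hτ : τ (Ψ v v / Ψ S.rep v) = Ψ v v / Ψ v S.rep := by
      rw [map_div₀, hΨ.apply_self, ← hΨ.hermitian]
    -- Rescale S.rep to have the same product with v as v itself; the difference from v then lies in
    -- v^⊥, and tangency makes it isotropic.
    refine ⟨(Ψ v v / Ψ S.rep v) • S.rep - v, ?_, ?_⟩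
    · simp only [mem_filter, mem_univ, true_and, mem_orthogonalTo, map_sub, map_smul,
        LinearMap.sub_apply, LinearMap.smul_apply, map_smulₛₗ, smul_eq_mul, RingHom.coe_coe, hτ,
        hS.1, mul_zero, zero_sub, and_true]
      constructor
      · field_simp; ring
      · field_simp
        linear_combination -Ψ v v * hT
    · exact span_eq_of_eq_smul _ (add_sub_cancel v _)

end Vertices

/-! ### The products A² and AB -/

section MatrixIdentities

variable {K V : Type*} [Field K] [AddCommGroup V] [Module K V] {τ : K ≃+* K}
  {Ψ : V →ₗ[K] V →ₛₗ[(τ : K →+* K)] K}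

open FrameVertex

open Classical in
/-- The adjacency matrix of the graph of nondegenerate `1`-dimensional subspaces. -/
noncomputable def adjacency (Ψ : V →ₗ[K] V →ₛₗ[(τ : K →+* K)] K) :
    Matrix (FrameVertex Ψ) (FrameVertex Ψ) ℝ :=
  .of fun P R => if Ψ P.rep R.rep = 0 then 1 else 0

open Classical in
/-- The matrix of the relation `FrameVertex.Tangent`. -/
noncomputable def tangency (Ψ : V →ₗ[K] V →ₛₗ[(τ : K →+* K)] K) :
    Matrix (FrameVertex Ψ) (FrameVertex Ψ) ℝ :=
  .of fun P R => if P.Tangent R then 1 else 0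

lemma adjacency_apply_of_eq_zero {P R : FrameVertex Ψ} (h : Ψ P.rep R.rep = 0) :
    adjacency Ψ P R = 1 := by simp [adjacency, h]

lemma adjacency_apply_of_ne_zero {P R : FrameVertex Ψ} (h : Ψ P.rep R.rep ≠ 0) :
    adjacency Ψ P R = 0 := by simp [adjacency, h]

lemma tangency_apply_of_tangent {P R : FrameVertex Ψ} (h : P.Tangent R) :
    tangency Ψ P R = 1 := by simp [tangency, h]

lemma tangency_apply_of_not_tangent {P R : FrameVertex Ψ} (h : ¬ P.Tangent R) :
    tangency Ψ P R = 0 := by simp [tangency, h]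

lemma adjacency_transpose (hΨ : IsUnitaryForm τ Ψ) : (adjacency Ψ).transpose = adjacency Ψ := by
  ext P R
  classical exact if_congr hΨ.eq_zero_comm rfl rfl

variable [Fintype K] [Fintype V] [FiniteDimensional K V] {q k : ℕ}

/-- The neighbours of P are the vertices in P^⊥, each accounting for q² - 1 of its nonisotropic
vectors. -/
lemma sum_adjacency (hΨ : IsUnitaryForm τ Ψ) (hq : Fintype.card K = q ^ 2)
    (hV : Fintype.card V = q ^ (2 * (k + 2))) (P : FrameVertex Ψ) :
    ∑ R, adjacency Ψ P R = (q : ℝ) ^ k * (q * q ^ k + (-1) ^ k) / (q + 1) := by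
  classical
  have hq1 : (1 : ℝ) < q := by exact_mod_cast one_lt_of_card_eq_sq hq
  have h := card_rep_mem (Ψ := Ψ) hq (orthogonalTo Ψ P.rep)
  have hsum : ∑ R, adjacency Ψ P R = #{S : FrameVertex Ψ | S.rep ∈ orthogonalTo Ψ P.rep} := by
    simp [adjacency, hΨ.eq_zero_comm (v := P.rep)]
  have h' := congrArg (Nat.cast (R := ℝ)) h
  rw [vectorCount_orthogonalTo hq hV P.rep_self_ne_zero] at h'
  have hpos : 1 ≤ q ^ 2 := Nat.one_le_pow _ _ (by have := one_lt_of_card_eq_sq hq; omega)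
  push_cast [Nat.cast_sub hpos] at h'
  rw [isotropicCount_orthogonalTo hΨ hq hV P.rep_self_ne_zero, ← hsum] at h'
  have hne : (q : ℝ) ^ 2 - 1 ≠ 0 := by nlinarith
  have hne' : (q : ℝ) + 1 ≠ 0 := by linarith
  refine mul_left_cancel₀ hne ?_
  rw [eq_sub_of_add_eq h']
  field_simp
  ring

open Classical in
/-- The square of the adjacency matrix. -/
lemma adjacency_mul_adjacency (hΨ : IsUnitaryForm τ Ψ) (hq : Fintype.card K = q ^ 2)
    (hV : Fintype.card V = q ^ (2 * (k + 2))) (P R : FrameVertex Ψ) :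
    (adjacency Ψ * adjacency Ψ) P R =
      (if P = R then ((q : ℝ) ^ k) ^ 2 * (q - 1) / q else 0) +
      (q : ℝ) ^ k * (q ^ k - (-1) ^ k) / (q * (q + 1)) +
      (-1) ^ k * q ^ k / q * tangency Ψ P R := by
  classical
  have hq1 : (1 : ℝ) < q := by exact_mod_cast one_lt_of_card_eq_sq hq
  have hq0 : (q : ℝ) ≠ 0 := by linarith
  have hne : (q : ℝ) ^ 2 - 1 ≠ 0 := by nlinarith
  have hne' : (q : ℝ) + 1 ≠ 0 := by linarith
  have hpos : 1 ≤ q ^ 2 := Nat.one_le_pow _ _ (by have := one_lt_of_card_eq_sq hq; omega)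
  -- The entry counts vertices in R^⊥ ∩ P^⊥; only three cases matter, P = R, tangent, and neither,
  -- which is why I, J and B suffice.
  have hmul : (adjacency Ψ * adjacency Ψ) P R =
      #{S : FrameVertex Ψ | S.rep ∈ orthogonalTo Ψ R.rep ⊓ orthogonalTo Ψ P.rep} := by
    rw [Matrix.mul_apply, card_filter]
    push_cast
    refine sum_congr rfl fun S _ => ?_
    by_cases h1 : Ψ S.rep P.rep = 0 <;> by_cases h2 : Ψ S.rep R.rep = 0 <;>
      simp [adjacency, h1, h2, hΨ.eq_zero_comm (v := P.rep)]
  have h := card_rep_mem (Ψ := Ψ) hq (orthogonalTo Ψ R.rep ⊓ orthogonalTo Ψ P.rep)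
  have h' := congrArg (Nat.cast (R := ℝ)) h
  push_cast [Nat.cast_sub hpos] at h'
  rw [← hmul] at h'
  refine mul_left_cancel₀ hne ?_
  by_cases hPR : P = R
  · subst hPR
    rw [inf_idem, vectorCount_orthogonalTo hq hV P.rep_self_ne_zero,
      isotropicCount_orthogonalTo hΨ hq hV P.rep_self_ne_zero] at h'
    rw [if_pos rfl, tangency_apply_of_tangent P.tangent_self, eq_sub_of_add_eq h']
    push_cast
    field_simp
    ring
  · have hw := mt rep_sub_smul_eq_zero_iff.1 hPR
    rw [(vectorCount_orthogonalTo_inf hΨ hq hV R.rep_self_ne_zero hw).1] at h'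
    rw [if_neg hPR, eq_sub_of_add_eq h']
    by_cases hT : P.Tangent R
    · rw [tangency_apply_of_tangent hT,
        isotropicCount_orthogonalTo_inf_of_eq hΨ hq hV R.rep_self_ne_zero hT hw]
      push_cast
      field_simp
      ring
    · rw [tangency_apply_of_not_tangent hT,
        isotropicCount_orthogonalTo_inf_of_ne hΨ hq hV R.rep_self_ne_zero hT]
      push_cast
      field_simp
      ring

open Classical in
/-- The product of the adjacency and tangency matrices. -/
lemma adjacency_mul_tangency (hΨ : IsUnitaryForm τ Ψ) (hq : Fintype.card K = q ^ 2)
    (hV : Fintype.card V = q ^ (2 * (k + 2))) (P R : FrameVertex Ψ) :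
    (adjacency Ψ * tangency Ψ) P R =
      (-1) ^ k * q ^ k * adjacency Ψ P R + (-1) ^ k * q ^ k / q * tangency Ψ P R -
      (if P = R then ((q : ℝ) ^ k) ^ 2 / q else 0) +
      (q : ℝ) ^ k * (q ^ k - (-1) ^ k) / q := by
  classical
  have hq1 : (1 : ℝ) < q := by exact_mod_cast one_lt_of_card_eq_sq hq
  have hq0 : (q : ℝ) ≠ 0 := by linarith
  have hne : (q : ℝ) ^ 2 - 1 ≠ 0 := by nlinarith
  have hpos : 1 ≤ q ^ 2 := Nat.one_le_pow _ _ (by have := one_lt_of_card_eq_sq hq; omega)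
  have hmul : (adjacency Ψ * tangency Ψ) P R =
      #{r : V | (r ∈ orthogonalTo Ψ R.rep ∧ Ψ r r = 0) ∧ Ψ r P.rep = -Ψ R.rep P.rep} := by
    rw [← card_orthogonal_tangent hΨ, Matrix.mul_apply, card_filter]
    push_cast
    refine sum_congr rfl fun S _ => ?_
    by_cases h1 : Ψ S.rep P.rep = 0 <;> by_cases h2 : S.Tangent R <;>
      simp [adjacency, tangency, h1, h2, hΨ.eq_zero_comm (v := P.rep)]
  -- If P ⊥ R, the prescribed value of Ψ r P is 0 and r ranges over the isotropic vectors of R^⊥ ∩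
  -- P^⊥. Otherwise it is nonzero, and the even distribution over nonzero values gives the count.
  by_cases hA : Ψ P.rep R.rep = 0
  · have hT : ¬ P.Tangent R := fun h => h.apply_ne_zero hA
    have hPR : P ≠ R := by rintro rfl; exact P.rep_self_ne_zero hA
    have hc : #{r : V | (r ∈ orthogonalTo Ψ R.rep ∧ Ψ r r = 0) ∧ Ψ r P.rep = -Ψ R.rep P.rep} =
        isotropicCount Ψ (orthogonalTo Ψ R.rep ⊓ orthogonalTo Ψ P.rep) := by
      rw [isotropicCount, hΨ.eq_zero_comm.1 hA, neg_zero]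
      congr 1
      ext r
      simp only [mem_filter, mem_univ, true_and, Submodule.mem_inf, mem_orthogonalTo]
      tauto
    rw [hmul, hc, isotropicCount_orthogonalTo_inf_of_ne hΨ hq hV R.rep_self_ne_zero hT,
      adjacency_apply_of_eq_zero hA, tangency_apply_of_not_tangent hT, if_neg hPR]
    field_simp
    ring
  · have hRP : -Ψ R.rep P.rep ≠ 0 := neg_ne_zero.2 fun h => hA (hΨ.eq_zero_comm.1 h)
    have h := card_isotropic_apply_eq (Ψ := Ψ) hq (orthogonalTo Ψ R.rep) P.rep hRP
    have h' := congrArg (Nat.cast (R := ℝ)) h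
    push_cast [Nat.cast_sub hpos] at h'
    rw [← hmul] at h'
    refine mul_left_cancel₀ hne ?_
    rw [eq_sub_of_add_eq h', isotropicCount_orthogonalTo hΨ hq hV R.rep_self_ne_zero,
      adjacency_apply_of_ne_zero hA]
    by_cases hPR : P = R
    · subst hPR
      rw [inf_idem, isotropicCount_orthogonalTo hΨ hq hV P.rep_self_ne_zero, if_pos rfl,
        tangency_apply_of_tangent P.tangent_self]
      field_simp
      ring
    · have hw := mt rep_sub_smul_eq_zero_iff.1 hPR
      rw [if_neg hPR]
      by_cases hT : P.Tangent R
      · rw [tangency_apply_of_tangent hT,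
          isotropicCount_orthogonalTo_inf_of_eq hΨ hq hV R.rep_self_ne_zero hT hw]
        field_simp
        ring
      · rw [tangency_apply_of_not_tangent hT,
          isotropicCount_orthogonalTo_inf_of_ne hΨ hq hV R.rep_self_ne_zero hT]
        field_simp
        ring

end MatrixIdentities

/-! ### Linear algebra from the two matrix identities -/

section Spectrum

open Matrix

variable {ι : Type*} [Fintype ι]

/-- If the columns of `A` sum to `d`, then an eigenvalue of `A` is `d` or belongs to an eigenvector
of sum zero. -/
lemma eq_or_sum_eq_zero_of_mulVec_eq_smul {A : Matrix ι ι ℝ} {d μ : ℝ} {f : ι → ℝ}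
    (hA : ∀ j, ∑ i, A i j = d) (hf : A *ᵥ f = μ • f) : μ = d ∨ ∑ i, f i = 0 := by
  have h : ∑ i, (A *ᵥ f) i = d * ∑ j, f j := by
    simp only [mulVec, dotProduct]
    rw [sum_comm, mul_sum]
    exact sum_congr rfl fun j _ => by rw [← sum_mul, hA]
  rw [hf] at h
  simp only [Pi.smul_apply, smul_eq_mul, ← mul_sum] at h
  have h2 : (μ - d) * ∑ i, f i = 0 := by linear_combination h
  exact (mul_eq_zero.1 h2).imp_left sub_eq_zero.1

lemma const_mulVec_eq_zero {f : ι → ℝ} (hf : ∑ i, f i = 0) :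
    (Matrix.of fun _ _ : ι => (1 : ℝ)) *ᵥ f = 0 := by
  ext i
  simp [mulVec, dotProduct, hf]

variable [DecidableEq ι] {A B : Matrix ι ι ℝ} {q b N c μ : ℝ} {f : ι → ℝ}

/-- With b = (-1)^k q^k / q the other coefficients are polynomials in b and q; those of J play no
role on vectors of sum zero. -/
lemma mulVec_mulVec_of_sum_eq_zero
    (h1 : A * A = (b ^ 2 * q ^ 2 - b ^ 2 * q) • (1 : Matrix ι ι ℝ) +
      N • Matrix.of (fun _ _ => (1 : ℝ)) + b • B) (hf : ∑ i, f i = 0) :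
    A *ᵥ (A *ᵥ f) = (b ^ 2 * q ^ 2 - b ^ 2 * q) • f + b • (B *ᵥ f) := by
  rw [mulVec_mulVec, h1, add_mulVec, add_mulVec, smul_mulVec, smul_mulVec, smul_mulVec,
    one_mulVec, const_mulVec_eq_zero hf, smul_zero, add_zero]

lemma mulVec_tangency_of_sum_eq_zero
    (h2 : A * B = (b * q) • A + b • B - (b ^ 2 * q) • (1 : Matrix ι ι ℝ) +
      c • Matrix.of (fun _ _ => (1 : ℝ))) (hf : ∑ i, f i = 0) :
    A *ᵥ (B *ᵥ f) = (b * q) • (A *ᵥ f) + b • (B *ᵥ f) - (b ^ 2 * q) • f := by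
  rw [mulVec_mulVec, h2, add_mulVec, sub_mulVec, add_mulVec, smul_mulVec, smul_mulVec, smul_mulVec,
    smul_mulVec, one_mulVec, const_mulVec_eq_zero hf, smul_zero, add_zero]

/-- The eigenvalues on vectors of sum zero. -/
lemma eq_or_sq_eq_of_mulVec_eq_smul
    (h1 : A * A = (b ^ 2 * q ^ 2 - b ^ 2 * q) • (1 : Matrix ι ι ℝ) +
      N • Matrix.of (fun _ _ => (1 : ℝ)) + b • B)
    (h2 : A * B = (b * q) • A + b • B - (b ^ 2 * q) • (1 : Matrix ι ι ℝ) +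
      c • Matrix.of (fun _ _ => (1 : ℝ)))
    (hf : ∑ i, f i = 0) (hf0 : f ≠ 0) (hμ : A *ᵥ f = μ • f) : μ = b ∨ μ ^ 2 = (b * q) ^ 2 := by
  have e1 := mulVec_mulVec_of_sum_eq_zero h1 hf
  have e2 := mulVec_tangency_of_sum_eq_zero h2 hf
  -- A is applied to b B f, expressed through A² f, so that the formula for AB eliminates B without
  -- dividing by b.
  have e3 : A *ᵥ (b • (B *ᵥ f)) =
      A *ᵥ (μ • μ • f - (b ^ 2 * q ^ 2 - b ^ 2 * q) • f) := by
    congr 1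
    rw [hμ, mulVec_smul, hμ] at e1
    rw [e1, add_sub_cancel_left]
  rw [mulVec_smul, e2, mulVec_sub, mulVec_smul, mulVec_smul, mulVec_smul, hμ] at e3
  rw [hμ, mulVec_smul, hμ] at e1
  obtain ⟨i, hi⟩ := Function.ne_iff.1 hf0
  have e1i := congrFun e1 i
  have e3i := congrFun e3 i
  simp only [Pi.add_apply, Pi.sub_apply, Pi.smul_apply, smul_eq_mul, Pi.zero_apply] at e1i e3i hi
  have h : (μ - b) * (μ ^ 2 - (b * q) ^ 2) * f i = 0 := by
    linear_combination -e3i - b * e1i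
  rcases mul_eq_zero.1 ((mul_eq_zero.1 h).resolve_right hi) with h | h
  · exact Or.inl (sub_eq_zero.1 h)
  · exact Or.inr (sub_eq_zero.1 h)

lemma sum_single_sub_single (i j : ι) :
    ∑ l, (Pi.single i 1 - Pi.single j 1 : ι → ℝ) l = 0 := by
  simp

lemma mulVec_single_sub_single (M : Matrix ι ι ℝ) (i j l : ι) :
    (M *ᵥ (Pi.single i 1 - Pi.single j 1)) l = M l i - M l j := by
  rw [mulVec_sub]
  simp

/-- The second identity factors as (A - b)(B - bq) = c J. -/
lemma mulVec_eq_smul_of_tangency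
    (h2 : A * B = (b * q) • A + b • B - (b ^ 2 * q) • (1 : Matrix ι ι ℝ) +
      c • Matrix.of (fun _ _ => (1 : ℝ))) (hf : ∑ i, f i = 0) :
    A *ᵥ (B *ᵥ f - (b * q) • f) = b • (B *ᵥ f - (b * q) • f) := by
  rw [mulVec_sub, mulVec_smul, mulVec_tangency_of_sum_eq_zero h2 hf]
  ext i
  simp only [Pi.add_apply, Pi.sub_apply, Pi.smul_apply, smul_eq_mul]
  ring

/-- The vector is (A - b)(A + μ)f with A² expanded, and (A - μ)(A + μ)(A - b) kills vectors of sum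
zero. -/
lemma mulVec_eq_smul_of_sq_eq
    (h1 : A * A = (b ^ 2 * q ^ 2 - b ^ 2 * q) • (1 : Matrix ι ι ℝ) +
      N • Matrix.of (fun _ _ => (1 : ℝ)) + b • B)
    (h2 : A * B = (b * q) • A + b • B - (b ^ 2 * q) • (1 : Matrix ι ι ℝ) +
      c • Matrix.of (fun _ _ => (1 : ℝ)))
    (hf : ∑ i, f i = 0) (hμ : μ ^ 2 = (b * q) ^ 2) :
    A *ᵥ ((b ^ 2 * q ^ 2 - b ^ 2 * q - μ * b) • f + b • (B *ᵥ f) + (μ - b) • (A *ᵥ f)) =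
      μ • ((b ^ 2 * q ^ 2 - b ^ 2 * q - μ * b) • f + b • (B *ᵥ f) + (μ - b) • (A *ᵥ f)) := by
  rw [mulVec_add, mulVec_add, mulVec_smul, mulVec_smul, mulVec_smul,
    mulVec_tangency_of_sum_eq_zero h2 hf, mulVec_mulVec_of_sum_eq_zero h1 hf]
  ext i
  simp only [Pi.add_apply, Pi.sub_apply, Pi.smul_apply, smul_eq_mul]
  linear_combination (b * f i - (A *ᵥ f) i) * hμ

end Spectrum

/-! ### Specialisation to the graph, and special pairs of vertices -/

section FrameGraphSpectrum

open FrameVertex Matrix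

variable {K V : Type*} [Field K] [AddCommGroup V] [Module K V] {τ : K ≃+* K}
  {Ψ : V →ₗ[K] V →ₛₗ[(τ : K →+* K)] K}

lemma mem_adjacencyEigenvalues_iff [Finite K] [FiniteDimensional K V] (hΨ : IsUnitaryForm τ Ψ)
    {μ : ℝ} : μ ∈ adjacencyEigenvalues (frameGraph hΨ) ↔
      ∃ f : FrameVertex Ψ → ℝ, f ≠ 0 ∧ adjacency Ψ *ᵥ f = μ • f := by
  classical
  have hadj : (frameGraph hΨ).adjMatrix ℝ = adjacency Ψ := by
    ext P R
    rw [SimpleGraph.adjMatrix_apply]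
    exact if_congr (adj_iff hΨ) rfl rfl
  rw [← hadj, adjacencyEigenvalues, Set.mem_ofPred_eq]
  constructor
  · intro h
    obtain ⟨f, hf⟩ := h.exists_hasEigenvector
    refine ⟨f, hf.2, ?_⟩
    have := hf.apply_eq_smul
    rw [toLin'_apply] at this
    convert this
  · rintro ⟨f, hf, h⟩
    refine Module.End.hasEigenvalue_of_hasEigenvector (x := f) ⟨?_, hf⟩
    rw [Module.End.mem_eigenspace_iff, toLin'_apply]
    convert h

/-- Over the field with four elements nonadjacent vertices are tangent. -/
lemma tangent_of_ne_zero [Fintype K] (hΨ : IsUnitaryForm τ Ψ) (hq : Fintype.card K = 2 ^ 2)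
    {P R : FrameVertex Ψ} (h : Ψ P.rep R.rep ≠ 0) : P.Tangent R := by
  classical
  -- The fixed field is {0, 1}, so both sides of the Gram equation, being fixed and nonzero, equal
  -- 1.
  have hone : ∀ x : K, τ x = x → x ≠ 0 → x = 1 := by
    intro x hx hx0
    have hF : ({0, 1} : Finset K) = ({y : K | τ y = y} : Finset K) := by
      refine eq_of_subset_of_card_le ?_ ?_
      · intro y hy
        rcases mem_insert.1 hy with rfl | hy
        · simp
        · rw [mem_singleton.1 hy]; simp
      · rw [card_fixedPoints hΨ.orderOf_eq hq, card_pair zero_ne_one]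
    have : x ∈ ({0, 1} : Finset K) := by rw [hF]; simpa using hx
    simpa [hx0] using this
  unfold Tangent
  rw [hone _ (hΨ.apply_self _) P.rep_self_ne_zero, hone _ (hΨ.apply_self _) R.rep_self_ne_zero,
    mul_one]
  refine hone _ ?_ (mul_ne_zero h fun h0 => h (hΨ.eq_zero_comm.1 h0))
  rw [map_mul, ← hΨ.hermitian, ← hΨ.hermitian, mul_comm]

lemma nonempty_frameVertex [Fintype K] [Fintype V] {q k : ℕ} (hΨ : IsUnitaryForm τ Ψ) (hq : Fintype.card K = q ^ 2)
    (hV : Fintype.card V = q ^ (2 * (k + 2))) : Nonempty (FrameVertex Ψ) := by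
  have hq1 := one_lt_of_card_eq_sq hq
  have : Nontrivial V := by
    rw [← Fintype.one_lt_card_iff_nontrivial, hV]
    exact Nat.one_lt_pow (by omega) hq1
  obtain ⟨x, hx⟩ := exists_ne (0 : V)
  obtain ⟨y, hy⟩ := hΨ.exists_apply_ne_zero hx
  obtain ⟨w, -, hw⟩ := hΨ.exists_apply_self_ne_zero (U := ⊤) (Submodule.mem_top (x := y))
    (Submodule.mem_top (x := x)) hy
  exact ⟨span w hw⟩

/-- In a plane distinct vertices are never tangent. -/
lemma FrameVertex.Tangent.eq_of_card_eq [Fintype K] [Fintype V] {q : ℕ} (hΨ : IsUnitaryForm τ Ψ) (hq : Fintype.card K = q ^ 2)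
    (hV : Fintype.card V = q ^ (2 * (0 + 2))) {P R : FrameVertex Ψ} (h : P.Tangent R) : P = R := by
  classical
  by_contra hPR
  have hw := mt rep_sub_smul_eq_zero_iff.1 hPR
  -- Here R^⊥ ∩ P^⊥ is zero, but tangency puts the projection of P.rep to R^⊥ inside it.
  have hc := (vectorCount_orthogonalTo_inf hΨ hq hV R.rep_self_ne_zero hw).1
  rw [mul_zero, pow_zero, vectorCount, card_eq_one] at hc
  obtain ⟨x, hx⟩ := hc
  have h0 : (0 : V) ∈ ({x} : Finset V) := by rw [← hx]; simp
  have h1 : P.rep - (Ψ P.rep R.rep / Ψ R.rep R.rep) • R.rep ∈ ({x} : Finset V) := by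
    rw [← hx, mem_filter, ← orthogonalTo_inf_sub_smul P.rep R.rep (Ψ P.rep R.rep / Ψ R.rep R.rep)]
    refine ⟨mem_univ _, sub_smul_mem_orthogonalTo _ R.rep_self_ne_zero, ?_⟩
    have hT : Ψ P.rep R.rep * Ψ R.rep P.rep = Ψ P.rep P.rep * Ψ R.rep R.rep := h
    rw [SetLike.mem_coe, mem_orthogonalTo, apply_sub_smul_self _ R.rep_self_ne_zero, hT, sub_self, zero_div]
  rw [mem_singleton] at h0 h1
  exact hw (h1.trans h0.symm)

variable [Fintype K] [Fintype V] [FiniteDimensional K V] {q k : ℕ}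

open Classical in
lemma adjacency_sq (hΨ : IsUnitaryForm τ Ψ) (hq : Fintype.card K = q ^ 2)
    (hV : Fintype.card V = q ^ (2 * (k + 2))) {b : ℝ} (hb : b = (-1) ^ k * q ^ k / q) :
    adjacency Ψ * adjacency Ψ =
      (b ^ 2 * (q : ℝ) ^ 2 - b ^ 2 * q) • (1 : Matrix (FrameVertex Ψ) (FrameVertex Ψ) ℝ) +
      ((q : ℝ) ^ k * (q ^ k - (-1) ^ k) / (q * (q + 1))) • Matrix.of (fun _ _ => (1 : ℝ)) +
      b • tangency Ψ := by
  have hq0 : (q : ℝ) ≠ 0 := by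
    have := one_lt_of_card_eq_sq hq
    positivity
  have hε : ((-1 : ℝ) ^ k) ^ 2 = 1 := by rw [← pow_mul, mul_comm, pow_mul]; norm_num
  ext P R
  rw [adjacency_mul_adjacency hΨ hq hV, hb]
  simp only [Matrix.add_apply, Matrix.smul_apply, one_apply, of_apply, smul_eq_mul, mul_one]
  split_ifs
  · rw [div_pow, mul_pow, hε]
    field_simp
  · ring

open Classical in
lemma adjacency_mul_tangency_eq (hΨ : IsUnitaryForm τ Ψ) (hq : Fintype.card K = q ^ 2)
    (hV : Fintype.card V = q ^ (2 * (k + 2))) {b : ℝ} (hb : b = (-1) ^ k * q ^ k / q) :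
    adjacency Ψ * tangency Ψ = (b * q) • adjacency Ψ + b • tangency Ψ -
      (b ^ 2 * q) • (1 : Matrix (FrameVertex Ψ) (FrameVertex Ψ) ℝ) +
      ((q : ℝ) ^ k * (q ^ k - (-1) ^ k) / q) • Matrix.of (fun _ _ => (1 : ℝ)) := by
  have hq0 : (q : ℝ) ≠ 0 := by
    have := one_lt_of_card_eq_sq hq
    positivity
  have hε : ((-1 : ℝ) ^ k) ^ 2 = 1 := by rw [← pow_mul, mul_comm, pow_mul]; norm_num
  ext P R
  rw [adjacency_mul_tangency hΨ hq hV, hb]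
  simp only [Matrix.add_apply, Matrix.sub_apply, Matrix.smul_apply, one_apply, of_apply, smul_eq_mul, mul_one]
  rw [div_mul_cancel₀ _ hq0]
  split_ifs
  · rw [div_pow, mul_pow, hε]
    field_simp
  · ring

lemma sum_adjacency_left (hΨ : IsUnitaryForm τ Ψ) (hq : Fintype.card K = q ^ 2)
    (hV : Fintype.card V = q ^ (2 * (k + 2))) (P : FrameVertex Ψ) :
    ∑ R, adjacency Ψ R P = (q : ℝ) ^ k * (q * q ^ k + (-1) ^ k) / (q + 1) := by
  rw [← sum_adjacency hΨ hq hV P]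
  exact sum_congr rfl fun R _ => congrFun (congrFun (adjacency_transpose hΨ) P) R

/-- The degree is positive. -/
lemma exists_adjacent (hΨ : IsUnitaryForm τ Ψ) (hq : Fintype.card K = q ^ 2)
    (hV : Fintype.card V = q ^ (2 * (k + 2))) (P : FrameVertex Ψ) :
    ∃ R : FrameVertex Ψ, Ψ P.rep R.rep = 0 := by
  by_contra! h
  have hsum := sum_adjacency hΨ hq hV P
  rw [sum_eq_zero fun R _ => adjacency_apply_of_ne_zero (h R)] at hsum
  have hq1 : (1 : ℝ) < q := by exact_mod_cast one_lt_of_card_eq_sq hq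
  have hX : (1 : ℝ) ≤ (q : ℝ) ^ k := one_le_pow₀ hq1.le
  have hε : (-1 : ℝ) ≤ (-1) ^ k := by
    rcases neg_one_pow_eq_or ℝ k with h | h <;> norm_num [h]
  have : 0 < (q : ℝ) ^ k * (q * q ^ k + (-1) ^ k) / (q + 1) := by
    apply div_pos (mul_pos (by linarith) _) (by linarith)
    nlinarith
  linarith

/-- For `q ≠ 2` some pair of vertices is neither adjacent nor tangent. -/
lemma exists_not_adjacent_not_tangent (hΨ : IsUnitaryForm τ Ψ) (hq : Fintype.card K = q ^ 2)
    (hV : Fintype.card V = q ^ (2 * (k + 2))) (hq2 : q ≠ 2) :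
    ∃ S R : FrameVertex Ψ, Ψ S.rep R.rep ≠ 0 ∧ ¬ S.Tangent R := by
  classical
  have hq1 := one_lt_of_card_eq_sq hq
  obtain ⟨P⟩ := nonempty_frameVertex hΨ hq hV
  obtain ⟨R, hR⟩ := exists_adjacent hΨ hq hV P
  have hP := P.rep_self_ne_zero
  have hRR := R.rep_self_ne_zero
  -- At most q + 1 scalars make P.rep + t R.rep isotropic, fewer than the q² - 1 nonzero ones once q
  -- ≥ 3.
  obtain ⟨t, ht, htn⟩ : ∃ t : K, t ≠ 0 ∧ t * τ t ≠ -Ψ P.rep P.rep / Ψ R.rep R.rep := by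
    by_contra! h
    have h1 := card_norm_fiber hΨ.orderOf_eq hq (c := -Ψ P.rep P.rep / Ψ R.rep R.rep)
      (by simp [map_div₀, hΨ.apply_self]) (div_ne_zero (neg_ne_zero.2 hP) hRR)
    have h2 : #((univ : Finset K).erase 0) ≤ q + 1 := by
      rw [← h1]
      refine card_le_card fun t ht => ?_
      simpa using h t (ne_of_mem_erase ht)
    rw [card_erase_of_mem (mem_univ _), card_univ, hq] at h2
    have h3 : 3 ≤ q := by omega
    have h4 : 3 * q ≤ q ^ 2 := by rw [pow_two]; exact Nat.mul_le_mul_right q h3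
    omega
  have hRP := hΨ.eq_zero_comm.1 hR
  have hself : Ψ (P.rep + t • R.rep) (P.rep + t • R.rep) =
      Ψ P.rep P.rep + t * τ t * Ψ R.rep R.rep := by
    simp only [map_add, map_smul, map_smulₛₗ, LinearMap.add_apply, LinearMap.smul_apply, hR, hRP,
      smul_eq_mul, mul_zero, add_zero, zero_add, RingHom.coe_coe]
    ring
  have hne : Ψ (P.rep + t • R.rep) (P.rep + t • R.rep) ≠ 0 := by
    rw [hself]
    intro h
    apply htn
    rw [eq_div_iff hRR]
    linear_combination h
  obtain ⟨c, hc, hrep⟩ := exists_rep_span _ hne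
  refine ⟨span _ hne, P, ?_, ?_⟩
  · rw [hrep]
    simp [hRP, hc, hP]
  -- The Gram determinant of P.rep + t R.rep and P.rep is t τ(t) Ψ(R, R) Ψ(P, P), which is nonzero.
  · rw [tangent_span_iff, hself]
    simp only [map_add, map_smul, map_smulₛₗ, LinearMap.add_apply, LinearMap.smul_apply, hR, hRP,
      smul_eq_mul, mul_zero, add_zero]
    intro h
    have h0 : t * τ t * Ψ R.rep R.rep * Ψ P.rep P.rep = 0 := by linear_combination -h
    simp [ht, hP, hRR] at h0

end FrameGraphSpectrum

/-! ### Which candidate eigenvalues occur -/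

section FrameGraphEigenvalues

open FrameVertex Matrix

variable {K V : Type*} [Field K] [AddCommGroup V] [Module K V] {τ : K ≃+* K}
  {Ψ : V →ₗ[K] V →ₛₗ[(τ : K →+* K)] K} [Fintype K] [Fintype V] [FiniteDimensional K V] {q k : ℕ}

lemma degree_mem_adjacencyEigenvalues (hΨ : IsUnitaryForm τ Ψ) (hq : Fintype.card K = q ^ 2)
    (hV : Fintype.card V = q ^ (2 * (k + 2))) :
    (q : ℝ) ^ k * (q * q ^ k + (-1) ^ k) / (q + 1) ∈ adjacencyEigenvalues (frameGraph hΨ) := by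
  have := nonempty_frameVertex hΨ hq hV
  rw [mem_adjacencyEigenvalues_iff]
  refine ⟨1, one_ne_zero, ?_⟩
  ext P
  simp [mulVec, dotProduct, sum_adjacency hΨ hq hV]

/-- Any eigenvalue is the degree or has an eigenvector of sum zero. -/
lemma eq_degree_or_exists_of_mem (hΨ : IsUnitaryForm τ Ψ) (hq : Fintype.card K = q ^ 2)
    (hV : Fintype.card V = q ^ (2 * (k + 2))) {μ : ℝ}
    (hμ : μ ∈ adjacencyEigenvalues (frameGraph hΨ)) :
    μ = (q : ℝ) ^ k * (q * q ^ k + (-1) ^ k) / (q + 1) ∨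
      ∃ f : FrameVertex Ψ → ℝ, f ≠ 0 ∧ ∑ P, f P = 0 ∧ adjacency Ψ *ᵥ f = μ • f := by
  obtain ⟨f, hf, h⟩ := (mem_adjacencyEigenvalues_iff hΨ).1 hμ
  exact (eq_or_sum_eq_zero_of_mulVec_eq_smul (sum_adjacency_left hΨ hq hV) h).imp_right
    fun h0 => ⟨f, hf, h0, h⟩

lemma eq_of_mem_adjacencyEigenvalues (hΨ : IsUnitaryForm τ Ψ) (hq : Fintype.card K = q ^ 2)
    (hV : Fintype.card V = q ^ (2 * (k + 2))) {b : ℝ} (hb : b = (-1) ^ k * q ^ k / q) {μ : ℝ}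
    (hμ : μ ∈ adjacencyEigenvalues (frameGraph hΨ)) :
    μ = (q : ℝ) ^ k * (q * q ^ k + (-1) ^ k) / (q + 1) ∨ μ = b ∨ μ ^ 2 = (b * q) ^ 2 := by
  classical
  refine (eq_degree_or_exists_of_mem hΨ hq hV hμ).imp_right ?_
  rintro ⟨f, hf, h0, h⟩
  exact eq_or_sq_eq_of_mulVec_eq_smul (adjacency_sq hΨ hq hV hb)
    (adjacency_mul_tangency_eq hΨ hq hV hb) h0 hf h

/-- The eigenvalue coming from the isotropic points; it needs dimension at least three. -/
lemma mem_adjacencyEigenvalues_of_pos (hΨ : IsUnitaryForm τ Ψ) (hq : Fintype.card K = q ^ 2)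
    (hV : Fintype.card V = q ^ (2 * (k + 2))) (hk : 0 < k) {b : ℝ}
    (hb : b = (-1) ^ k * q ^ k / q) : b ∈ adjacencyEigenvalues (frameGraph hΨ) := by
  classical
  have hq1 : (1 : ℝ) < q := by exact_mod_cast one_lt_of_card_eq_sq hq
  obtain ⟨P⟩ := nonempty_frameVertex hΨ hq hV
  obtain ⟨R, hR⟩ := exists_adjacent hΨ hq hV P
  have hPR : P ≠ R := by rintro rfl; exact P.rep_self_ne_zero hR
  rw [mem_adjacencyEigenvalues_iff]
  refine ⟨_, ?_, mulVec_eq_smul_of_tangency (adjacency_mul_tangency_eq hΨ hq hV hb)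
    (sum_single_sub_single P R)⟩
  -- At P the vector takes the value 1 - bq = 1 - (-1)^k q^k, which could vanish for k = 0.
  intro h
  have hP := congrFun h P
  rw [Pi.sub_apply, mulVec_single_sub_single, tangency_apply_of_tangent P.tangent_self,
    tangency_apply_of_not_tangent fun h => h.apply_ne_zero hR] at hP
  simp only [Pi.smul_apply, Pi.sub_apply, Pi.single_eq_same, Pi.single_eq_of_ne hPR, smul_eq_mul,
    Pi.zero_apply] at hP
  have hbq : b * q = (-1) ^ k * q ^ k := by rw [hb, div_mul_cancel₀ _ (by linarith)]
  have hX : 1 < (q : ℝ) ^ k := one_lt_pow₀ hq1 hk.ne'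
  rw [hbq] at hP
  rcases neg_one_pow_eq_or ℝ k with h | h <;> rw [h] at hP <;> linarith

lemma mem_adjacencyEigenvalues_of_sq_eq (hΨ : IsUnitaryForm τ Ψ) (hq : Fintype.card K = q ^ 2)
    (hV : Fintype.card V = q ^ (2 * (k + 2))) (hq2 : q ≠ 2) {μ : ℝ}
    (hμ : μ ^ 2 = ((q : ℝ) ^ k) ^ 2) : μ ∈ adjacencyEigenvalues (frameGraph hΨ) := by
  classical
  have hq1 : (1 : ℝ) < q := by exact_mod_cast one_lt_of_card_eq_sq hq
  have hX : 0 < (q : ℝ) ^ k := by positivity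
  have hε : ((-1 : ℝ) ^ k) ^ 2 = 1 := by rw [← pow_mul, mul_comm, pow_mul]; norm_num
  obtain ⟨b, hb⟩ : ∃ b : ℝ, b = (-1) ^ k * q ^ k / q := ⟨_, rfl⟩
  have hbq : b * q = (-1) ^ k * q ^ k := by rw [hb, div_mul_cancel₀ _ (by linarith)]
  have hμb : μ ^ 2 = (b * q) ^ 2 := by rw [hbq, mul_pow, hε, one_mul, hμ]
  obtain ⟨S, R, hSR, hT⟩ := exists_not_adjacent_not_tangent hΨ hq hV hq2
  obtain ⟨P, hP⟩ := exists_adjacent hΨ hq hV S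
  have hSP : S ≠ P := by rintro rfl; exact S.rep_self_ne_zero hP
  have hSR' : S ≠ R := by rintro rfl; exact hT S.tangent_self
  rw [mem_adjacencyEigenvalues_iff]
  refine ⟨_, ?_, mulVec_eq_smul_of_sq_eq (adjacency_sq hΨ hq hV hb)
    (adjacency_mul_tangency_eq hΨ hq hV hb) (sum_single_sub_single P R) hμb⟩
  -- S is adjacent to P but neither adjacent nor tangent to R, so the entry at S is μ - b; it is
  -- nonzero because μ² = q² b² with b ≠ 0.
  intro h
  have hS := congrFun h S
  simp only [Pi.add_apply, Pi.smul_apply, mulVec_single_sub_single,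
    tangency_apply_of_not_tangent hT, tangency_apply_of_not_tangent fun h => h.apply_ne_zero hP,
    adjacency_apply_of_eq_zero hP, adjacency_apply_of_ne_zero hSR, Pi.sub_apply,
    Pi.single_eq_of_ne hSP, Pi.single_eq_of_ne hSR', smul_eq_mul, Pi.zero_apply] at hS
  have hμb' : μ = b := by linarith
  rw [hμb', mul_pow] at hμb
  have hb0 : b ^ 2 * ((q : ℝ) ^ 2 - 1) = 0 := by linarith
  have hb1 : b ≠ 0 := by
    intro h0
    rw [h0, zero_mul, eq_comm, mul_eq_zero] at hbq
    rcases hbq with h | h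
    · rw [h] at hε; norm_num at hε
    · exact hX.ne' h
  rcases mul_eq_zero.1 hb0 with h | h
  · exact hb1 (pow_eq_zero_iff (two_ne_zero) |>.1 h)
  · nlinarith

/-- For planes the graph is a matching. -/
lemma adjacencyEigenvalues_of_plane (hΨ : IsUnitaryForm τ Ψ) (hq : Fintype.card K = q ^ 2)
    (hV : Fintype.card V = q ^ (2 * (0 + 2))) :
    adjacencyEigenvalues (frameGraph hΨ) = {1, -1} := by
  classical
  have hq1 : (1 : ℝ) < q := by exact_mod_cast one_lt_of_card_eq_sq hq
  have hd : (q : ℝ) ^ 0 * (q * q ^ 0 + (-1) ^ 0) / (q + 1) = 1 := by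
    have : (q : ℝ) + 1 ≠ 0 := by linarith
    field_simp
  have hone : tangency Ψ = 1 := by
    ext P R
    by_cases h : P = R
    · rw [h, one_apply_eq, tangency_apply_of_tangent R.tangent_self]
    · rw [one_apply_ne h,
        tangency_apply_of_not_tangent fun hT => h (hT.eq_of_card_eq hΨ hq hV)]
  -- For k = 0 the coefficient of J is 0, b = 1/q, and the remaining coefficients add up to 1.
  have hsq : adjacency Ψ * adjacency Ψ = 1 := by
    rw [adjacency_sq hΨ hq hV rfl, hone]
    ext P R
    simp only [Matrix.add_apply, Matrix.smul_apply, of_apply, smul_eq_mul]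
    field_simp
    ring
  ext μ
  simp only [Set.mem_insert_iff, Set.mem_singleton_iff]
  constructor
  · intro hμ
    obtain ⟨f, hf, h⟩ := (mem_adjacencyEigenvalues_iff hΨ).1 hμ
    have h1 : adjacency Ψ *ᵥ (adjacency Ψ *ᵥ f) = f := by rw [mulVec_mulVec, hsq, one_mulVec]
    rw [h, mulVec_smul, h, smul_smul] at h1
    have h2 : (μ * μ - 1) • f = 0 := by rw [sub_smul, h1, one_smul, sub_self]
    rw [smul_eq_zero, or_iff_left hf] at h2
    exact mul_self_eq_one_iff.1 (sub_eq_zero.1 h2)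
  · rintro (rfl | rfl)
    · rw [← hd]
      exact degree_mem_adjacencyEigenvalues hΨ hq hV
    · obtain ⟨P⟩ := nonempty_frameVertex hΨ hq hV
      rw [mem_adjacencyEigenvalues_iff]
      refine ⟨adjacency Ψ *ᵥ Pi.single P 1 - Pi.single P 1, ?_, ?_⟩
      · intro h
        have := congrFun h P
        simp [adjacency_apply_of_ne_zero P.rep_self_ne_zero] at this
      · rw [mulVec_sub, mulVec_mulVec, hsq, one_mulVec, neg_one_smul, neg_sub]

/-- Over the field with four elements the graph is strongly regular. -/
lemma adjacency_mulVec_mulVec_of_two (hΨ : IsUnitaryForm τ Ψ) (hq : Fintype.card K = 2 ^ 2)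
    (hV : Fintype.card V = 2 ^ (2 * (k + 2))) {b : ℝ} (hb : b = (-1) ^ k * 2 ^ k / 2)
    {f : FrameVertex Ψ → ℝ} (hf : ∑ P, f P = 0) :
    adjacency Ψ *ᵥ (adjacency Ψ *ᵥ f) = (2 * b ^ 2) • f - b • (adjacency Ψ *ᵥ f) := by
  classical
  have hB : tangency Ψ = Matrix.of (fun _ _ => (1 : ℝ)) - adjacency Ψ := by
    ext P R
    rw [Matrix.sub_apply, of_apply]
    by_cases h : Ψ P.rep R.rep = 0
    · rw [adjacency_apply_of_eq_zero h,
        tangency_apply_of_not_tangent fun hT => hT.apply_ne_zero h, sub_self]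
    · rw [adjacency_apply_of_ne_zero h, tangency_apply_of_tangent (tangent_of_ne_zero hΨ hq h),
        sub_zero]
  rw [mulVec_mulVec_of_sum_eq_zero (adjacency_sq (b := b) hΨ hq hV (by rw [hb]; norm_num)) hf, hB,
    sub_mulVec, const_mulVec_eq_zero hf]
  ext P
  simp only [Pi.add_apply, Pi.sub_apply, Pi.smul_apply, smul_eq_mul, Pi.zero_apply]
  push_cast
  ring

/-- On vectors of sum zero the quadratic relation is (A - b)(A + 2b) = 0. -/
lemma eq_of_mem_adjacencyEigenvalues_of_two (hΨ : IsUnitaryForm τ Ψ)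
    (hq : Fintype.card K = 2 ^ 2) (hV : Fintype.card V = 2 ^ (2 * (k + 2))) {b : ℝ}
    (hb : b = (-1) ^ k * 2 ^ k / 2) {μ : ℝ}
    (hμ : μ ∈ adjacencyEigenvalues (frameGraph hΨ)) :
    μ = (2 : ℝ) ^ k * (2 * 2 ^ k + (-1) ^ k) / (2 + 1) ∨ μ = b ∨ μ = -(2 * b) := by
  refine (eq_degree_or_exists_of_mem hΨ hq hV hμ).imp (fun h => by exact_mod_cast h) ?_
  rintro ⟨f, hf, h0, h⟩
  have h1 := adjacency_mulVec_mulVec_of_two hΨ hq hV hb h0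
  rw [h, mulVec_smul, h] at h1
  have h2 : ((μ - b) * (μ + 2 * b)) • f = 0 := by
    ext P
    have := congrFun h1 P
    simp only [Pi.sub_apply, Pi.smul_apply, smul_eq_mul, Pi.zero_apply] at this ⊢
    linear_combination this
  rw [smul_eq_zero, or_iff_left hf, mul_eq_zero] at h2
  exact h2.imp sub_eq_zero.1 eq_neg_of_add_eq_zero_left

lemma mem_adjacencyEigenvalues_of_two (hΨ : IsUnitaryForm τ Ψ)
    (hq : Fintype.card K = 2 ^ 2) (hV : Fintype.card V = 2 ^ (2 * (k + 2))) (hk : 1 < k) {b : ℝ}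
    (hb : b = (-1) ^ k * 2 ^ k / 2) : -(2 * b) ∈ adjacencyEigenvalues (frameGraph hΨ) := by
  classical
  obtain ⟨P⟩ := nonempty_frameVertex hΨ hq hV
  obtain ⟨R, hR⟩ := exists_adjacent hΨ hq hV P
  have hPR : P ≠ R := by rintro rfl; exact P.rep_self_ne_zero hR
  have h1 := adjacency_mulVec_mulVec_of_two hΨ hq hV hb (sum_single_sub_single P R)
  rw [mem_adjacencyEigenvalues_iff]
  refine ⟨adjacency Ψ *ᵥ (Pi.single P 1 - Pi.single R 1) - b • (Pi.single P 1 - Pi.single R 1),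
    ?_, ?_⟩
  -- The entry of (A - b)(e_P - e_R) at P is -1 - b, which would be zero for k = 1, where b = -1.
  · intro h
    have hP := congrFun h P
    rw [Pi.sub_apply, mulVec_single_sub_single, adjacency_apply_of_ne_zero P.rep_self_ne_zero,
      adjacency_apply_of_eq_zero hR] at hP
    simp only [Pi.smul_apply, Pi.sub_apply, Pi.single_eq_same, Pi.single_eq_of_ne hPR,
      smul_eq_mul, Pi.zero_apply] at hP
    have hX : (2 : ℝ) ^ 2 ≤ 2 ^ k := pow_le_pow_right₀ one_le_two hk
    rcases neg_one_pow_eq_or ℝ k with h | h <;> rw [h] at hb <;> linarith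
  · rw [mulVec_sub, mulVec_smul, h1]
    ext S
    simp only [Pi.sub_apply, Pi.smul_apply, smul_eq_mul]
    ring

end FrameGraphEigenvalues

/-! ### Assembly of the four cases -/

/-- The eigenvalues of the adjacency matrix of the graph of non-degenerate `1`-dimensional
subspaces of an `n`-dimensional unitary space over the field with `q ^ 2` elements. -/
theorem theorem1p3 {K V : Type*} [Field K] [Finite K] [AddCommGroup V] [Module K V]
    [FiniteDimensional K V] (q n : ℕ) (hq : Nat.card K = q ^ 2)
    (hn : 2 ≤ n) (hdim : Module.finrank K V = n)
    (τ : K ≃+* K) (Ψ : V →ₗ[K] V →ₛₗ[(τ : K →+* K)] K) (hΨ : IsUnitaryForm τ Ψ)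
    (μ₁ μ₂ μ₃ μ₄ : ℝ)
    (hμ₁ : μ₁ = unitaryDegree q n)
    (hμ₂ : μ₂ = (q : ℝ) ^ ((n : ℤ) - 2))
    (hμ₃ : μ₃ = (-1 : ℝ) ^ n * (q : ℝ) ^ ((n : ℤ) - 3))
    (hμ₄ : μ₄ = -(q : ℝ) ^ ((n : ℤ) - 2)) :
    (n = 2 → adjacencyEigenvalues (frameGraph hΨ) = {μ₁, μ₄}) ∧
    (3 ≤ n → q ≠ 2 → adjacencyEigenvalues (frameGraph hΨ) = {μ₁, μ₂, μ₃, μ₄}) ∧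
    (n = 3 → q = 2 → adjacencyEigenvalues (frameGraph hΨ) = {μ₁, μ₃}) ∧
    (3 < n → q = 2 → adjacencyEigenvalues (frameGraph hΨ) = {μ₁, μ₃, (-1 : ℝ) ^ n * μ₄}) := by
  have := Module.finite_of_finite K (M := V)
  let _ : Fintype K := Fintype.ofFinite K
  let _ : Fintype V := Fintype.ofFinite V
  rw [Nat.card_eq_fintype_card] at hq
  -- With k = n - 2 the exponent n - 2 is natural, while q^(n-3) is kept as q^k / q since k may be
  -- 0.
  obtain ⟨k, rfl⟩ := Nat.exists_eq_add_of_le' hn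
  have hV : Fintype.card V = q ^ (2 * (k + 2)) := by
    rw [Module.card_eq_pow_finrank (K := K), hdim, hq, ← pow_mul]
  have hq1 : (1 : ℝ) < q := by exact_mod_cast one_lt_of_card_eq_sq hq
  have hq0 : (q : ℝ) ≠ 0 := by linarith
  have hX : (q : ℝ) ^ (((k + 2 : ℕ) : ℤ) - 2) = q ^ k := by
    rw [show ((k + 2 : ℕ) : ℤ) - 2 = (k : ℤ) by push_cast; ring, zpow_natCast]
  have hε : (-1 : ℝ) ^ (k + 2) = (-1) ^ k := by rw [pow_add]; norm_num
  rw [hX] at hμ₂ hμ₄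
  have h₁ : μ₁ = (q : ℝ) ^ k * (q * q ^ k + (-1) ^ k) / (q + 1) := by
    rw [hμ₁, unitaryDegree, hX, show ((k + 2 : ℕ) : ℤ) - 1 = ((k + 1 : ℕ) : ℤ) by push_cast; ring,
      zpow_natCast, zpow_natCast]
    ring
  have h₃ : μ₃ = (-1) ^ k * q ^ k / q := by
    rw [hμ₃, hε, show ((k + 2 : ℕ) : ℤ) - 3 = (k : ℤ) - 1 by push_cast; ring, zpow_sub_one₀ hq0,
      zpow_natCast, mul_div_assoc, div_eq_mul_inv]
  have hε2 : ((-1 : ℝ) ^ k) ^ 2 = 1 := by rw [← pow_mul, mul_comm, pow_mul]; norm_num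
  have h₃q : (μ₃ * q) ^ 2 = ((q : ℝ) ^ k) ^ 2 := by
    rw [h₃, div_mul_cancel₀ _ hq0, mul_pow, hε2, one_mul]
  have hmem₁ : μ₁ ∈ adjacencyEigenvalues (frameGraph hΨ) :=
    h₁ ▸ degree_mem_adjacencyEigenvalues hΨ hq hV
  refine ⟨fun h => ?_, fun h hq2 => ?_, fun h hq2 => ?_, fun h hq2 => ?_⟩
  · obtain rfl : k = 0 := by omega
    have h1 : μ₁ = 1 := by
      have : (q : ℝ) + 1 ≠ 0 := by linarith
      rw [h₁]
      field_simp
    rw [adjacencyEigenvalues_of_plane hΨ hq hV, h1, hμ₄, pow_zero]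
  · ext μ
    simp only [Set.mem_insert_iff, Set.mem_singleton_iff]
    constructor
    · intro hμ
      rcases eq_of_mem_adjacencyEigenvalues hΨ hq hV h₃ hμ with h | h | h
      · exact Or.inl (h.trans h₁.symm)
      · exact Or.inr (Or.inr (Or.inl h))
      · rw [h₃q, sq_eq_sq_iff_eq_or_eq_neg, ← hμ₄, ← hμ₂] at h
        tauto
    · rintro (rfl | rfl | rfl | rfl)
      · exact hmem₁
      · exact mem_adjacencyEigenvalues_of_sq_eq hΨ hq hV hq2 (by rw [hμ₂])
      · exact mem_adjacencyEigenvalues_of_pos hΨ hq hV (by omega) h₃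
      · exact mem_adjacencyEigenvalues_of_sq_eq hΨ hq hV hq2 (by rw [hμ₄, neg_sq])
  · subst hq2
    obtain rfl : k = 1 := by omega
    push_cast at h₁ h₃
    ext μ
    simp only [Set.mem_insert_iff, Set.mem_singleton_iff]
    constructor
    · intro hμ
      rcases eq_of_mem_adjacencyEigenvalues_of_two hΨ hq hV h₃ hμ with h | h | h
      · exact Or.inl (h.trans h₁.symm)
      · exact Or.inr h
      -- For n = 3 and q = 2, -2μ₃ = 2 is the degree, so no third eigenvalue appears.
      · left
        rw [h, h₁, h₃]
        norm_num
    · rintro (rfl | rfl)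
      · exact hmem₁
      · exact mem_adjacencyEigenvalues_of_pos hΨ hq hV one_pos (by rw [h₃]; norm_num)
  · subst hq2
    push_cast at h₁ h₃ hμ₄
    have h₄ : (-1 : ℝ) ^ (k + 2) * μ₄ = -(2 * μ₃) := by
      rw [hε, hμ₄, h₃]
      ring
    rw [h₄]
    ext μ
    simp only [Set.mem_insert_iff, Set.mem_singleton_iff]
    constructor
    · intro hμ
      rcases eq_of_mem_adjacencyEigenvalues_of_two hΨ hq hV h₃ hμ with h | h | h
      · exact Or.inl (h.trans h₁.symm)
      · exact Or.inr (Or.inl h)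
      · exact Or.inr (Or.inr h)
    · rintro (rfl | rfl | rfl)
      · exact hmem₁
      · exact mem_adjacencyEigenvalues_of_pos hΨ hq hV (by omega) (by rw [h₃]; norm_num)
      · exact mem_adjacencyEigenvalues_of_two hΨ hq hV (by omega) h₃
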